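/- **Definitions.** An oriented graph $H$ has edge set $E(H)$ and $\|H\|$ edges. A *tournamenton* is a bounded measurable function $W:[0,1]^2\to[0,\infty)$ with $W(x,y)+W(y,x)=1$ for all $(x,y)\in[0,1]^2$. The homomorphism density of $H$ in $W$ is $t(H,W)=\int_{[0,1]^{V(H)}}\prod_{vw\in E(H)}W(x_v,x_w)\,\mathrm dx_{V(H)}$. The oriented graph $H$ is *quasirandom-forcing* if every tournamenton $W$ with $t(H,W)=2^{-\|H\|}$ is equal to $1/2$ almost everywhere. For $n\ge 1$, $Q_{2n}$ is the path with $2n$ edges, all of them oriented from the central vertex towards the two end vertices. For even $\ell\ge 4$, $D_\ell$ is the cycle of length $\ell$ with all edges oriented from one vertex towards the opposite vertex. For an orientation $C$ of a cycle and $F\subseteq E(C)$, let $C\langle F\rangle$ be the spanning subgraph of $C$ with edge set $F$. For positive integers $n_1,\dots,n_k$, let $\alpha_C(2n_1,\dots,2n_k)$ be the number of sets $F\subseteq E(C)$ such that $C\langle F\rangle$ can be obtained from the disjoint union $Q_{2n_1}\cup\dots\cup Q_{2n_k}$ by reversing an even number of edges and possibly adding isolated vertices, minus the number of sets $F\subseteq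 E(C)$ for which the same holds with an odd number of reversed edges. If $C$ is an orientation of a cycle of even length $\ell$, let $\gamma_C=+1$ if $C$ can be obtained from $D_\ell$ by reversing an even number of edges, and $\gamma_C=-1$ otherwise. **Theorem.** Let $C$ be an orientation of a cycle of even length $\ell$. Then $C$ is quasirandom-forcing if $\gamma_C=1$, \[\frac{\alpha_C(2)}{2^{\ell-2}}+\sum_{n_1=2}^{\ell/2-1}\frac{\min\{0,\alpha_C(2n_1)\}}{\pi^{2n_1-2}\cdot 2^{\ell-2n_1}}\ge 0\] and \[\frac{\alpha_C(2,2)}{2^{\ell-4}}+\sum_{\substack{k\ge 2,\ 1\le n_1\le\cdots\le n_k\\ 6<k+2n_1+\cdots+2n_k\le\ell}}\frac{\min\{0,\alpha_C(2n_1,\ldots,2n_k)\}}{12^{k-2}\cdot\pi^{2n_1+\cdots+2n_k-2k}\cdot 2^{\ell-2n_1-\cdots-2n_k}}\ge 0.\] Similarly, $C$ is quasirandom-forcing if $\gamma_C=-1$, \[\frac{\alpha_C(2)}{2^{\ell-2}}+\sum_{n_1=2}^{\ell/2-1}\frac{\max\{0,\alpha_C(2n_1)\}}{\pi^{2n_1-2}\cdot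 2^{\ell-2n_1}}\le 0\] and \[\frac{\alpha_C(2,2)}{2^{\ell-4}}+\sum_{\substack{k\ge 2,\ 1\le n_1\le\cdots\le n_k\\ 6<k+2n_1+\cdots+2n_k\le\ell}}\frac{\max\{0,\alpha_C(2n_1,\ldots,2n_k)\}}{12^{k-2}\cdot\pi^{2n_1+\cdots+2n_k-2k}\cdot 2^{\ell-2n_1-\cdots-2n_k}}\le 0.\] -/

import Mathlib

open MeasureTheory
open scoped unitInterval

/-- An oriented graph: every two vertices are joined by at most one arc, and there are no loops. -/
structure OrientedGraph (V : Type*) where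
  Adj : V → V → Prop
  asymm : ∀ u v, Adj u v → ¬ Adj v u

namespace OrientedGraph

/-- The underlying undirected graph. -/
def underlying {V : Type*} (G : OrientedGraph V) : SimpleGraph V where
  Adj u v := G.Adj u v ∨ G.Adj v u
  symm := ⟨fun _ _ h => h.symm⟩
  loopless := ⟨fun v h => h.elim (fun h' => G.asymm v v h' h') (fun h' => G.asymm v v h' h')⟩

/-- `G` is an orientation of a cycle of length `ℓ`. -/
def IsCycleOrientation {V : Type*} (G : OrientedGraph V) (ℓ : ℕ) : Prop :=
  3 ≤ ℓ ∧ Nonempty (G.underlying ≃g SimpleGraph.cycleGraph ℓ)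

open Classical in
/-- The set of edges of `G`; the edge directed from `u` to `v` is the pair `(u, v)`. -/
noncomputable def edges {V : Type*} [Fintype V] (G : OrientedGraph V) : Finset (V × V) :=
  Finset.univ.filter fun e => G.Adj e.1 e.2

/-- The spanning subgraph of `G` whose edges are the edges of `G` that belong to `F`. -/
def spanning {V : Type*} (G : OrientedGraph V) (F : Finset (V × V)) : OrientedGraph V where
  Adj u v := G.Adj u v ∧ (u, v) ∈ F
  asymm u v h h' := G.asymm u v h.1 h'.1

/-- The oriented graph obtained from `G` by reversing the edges of `G` that belong to `R`. -/
def reverse {V : Type*} (G : OrientedGraph V) (R : Finset (V × V)) : OrientedGraph V where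
  Adj u v := (G.Adj u v ∧ (u, v) ∉ R) ∨ (G.Adj v u ∧ (v, u) ∈ R)
  asymm u v := by
    rintro (⟨h, hR⟩ | ⟨h, hR⟩) (⟨h', hR'⟩ | ⟨h', hR'⟩)
    · exact G.asymm u v h h'
    · exact hR hR'
    · exact hR' hR
    · exact G.asymm u v h' h

/-- `H` is a copy of `G` with possibly some isolated vertices added. -/
def IsCopyWithIsolated {V W : Type*} (H : OrientedGraph W) (G : OrientedGraph V) : Prop :=
  ∃ f : V ↪ W, ∀ a b, H.Adj a b ↔ ∃ u v, f u = a ∧ f v = b ∧ G.Adj u v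

/-- `H` can be obtained from `G` by reversing an even number of edges
and possibly adding some isolated vertices. -/
def EvenReversal {V W : Type*} [Fintype V] (H : OrientedGraph W) (G : OrientedGraph V) : Prop :=
  ∃ R ⊆ G.edges, Even R.card ∧ H.IsCopyWithIsolated (G.reverse R)

/-- `H` can be obtained from `G` by reversing an odd number of edges
and possibly adding some isolated vertices. -/
def OddReversal {V W : Type*} [Fintype V] (H : OrientedGraph W) (G : OrientedGraph V) : Prop :=
  ∃ R ⊆ G.edges, Odd R.card ∧ H.IsCopyWithIsolated (G.reverse R)

/-- The disjoint union of a family of oriented graphs. -/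
def disjUnion {ι : Type*} {V : ι → Type*} (G : ∀ i, OrientedGraph (V i)) :
    OrientedGraph (Σ i, V i) where
  Adj a b := ∃ (i : ι) (u v : V i), a = ⟨i, u⟩ ∧ b = ⟨i, v⟩ ∧ (G i).Adj u v
  asymm a b := by
    rintro ⟨i, u, v, rfl, rfl, h⟩ ⟨j, u', v', h₁, h₂, h'⟩
    obtain ⟨rfl, h₁⟩ := Sigma.mk.inj_iff.mp h₁
    obtain ⟨-, h₂⟩ := Sigma.mk.inj_iff.mp h₂
    obtain rfl := eq_of_heq h₁
    obtain rfl := eq_of_heq h₂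
    exact (G i).asymm _ _ h h'

/-- `pathQ n` is the oriented graph `Q_{2n}`: the path `0, 1, …, 2n` with `2n` edges, all directed
from the central vertex `n` towards the two end vertices. -/
def pathQ (n : ℕ) : OrientedGraph (Fin (2 * n + 1)) where
  Adj i j := (n ≤ i.val ∧ j.val = i.val + 1) ∨ (i.val ≤ n ∧ i.val = j.val + 1)
  asymm i j := by omega

/-- `cycleD k` is the oriented graph `D_{2k}` (for `2 ≤ k`): the cycle `0, 1, …, 2k - 1` with all
edges directed from the vertex `0` towards the opposite vertex `k`, i.e. with the edges
`0 → 1 → ⋯ → k` and `0 → 2k - 1 → 2k - 2 → ⋯ → k`. -/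
def cycleD (k : ℕ) : OrientedGraph (Fin (2 * k)) where
  Adj i j := (i.val < k ∧ j.val = i.val + 1) ∨ (k ≤ j.val ∧ i.val = j.val + 1) ∨
    (i.val = 0 ∧ j.val + 1 = 2 * k)
  asymm i j := by omega

open Classical in
/-- The coefficient `α_C(2 n_1, …, 2 n_k)`. -/
noncomputable def alpha {V : Type*} [Fintype V] (C : OrientedGraph V) {k : ℕ} (n : Fin k → ℕ) : ℤ :=
  ((C.edges.powerset.filter fun F =>
      (C.spanning F).EvenReversal (disjUnion fun i => pathQ (n i))).card : ℤ) -
  ((C.edges.powerset.filter fun F =>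
      (C.spanning F).OddReversal (disjUnion fun i => pathQ (n i))).card : ℤ)

open Classical in
/-- The sign `γ_C` of an orientation `C` of an even cycle (whose length is the number of vertices).
No isolated vertex can be added here, since `C` and `D_ℓ` have equally many vertices. -/
noncomputable def gamma {V : Type*} [Fintype V] (C : OrientedGraph V) : ℤ :=
  if C.EvenReversal (cycleD (Fintype.card V / 2)) then 1 else -1

/-- A kernel: a bounded measurable function on the unit square. -/
def IsKernel (U : I → I → ℝ) : Prop :=
  Measurable (Function.uncurry U) ∧ ∃ M : ℝ, ∀ x y, |U x y| ≤ M

/-- A tournamenton: a non-negative kernel `W` with `W(x, y) + W(y, x) = 1` everywhere. -/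
def IsTournamenton (W : I → I → ℝ) : Prop :=
  IsKernel W ∧ (∀ x y, 0 ≤ W x y) ∧ ∀ x y, W x y + W y x = 1

/-- The homomorphism density `t(H, U)` of an oriented graph in a kernel. -/
noncomputable def homDensity {V : Type*} [Fintype V] (H : OrientedGraph V) (U : I → I → ℝ) : ℝ :=
  ∫ x : V → I, ∏ e ∈ H.edges, U (x e.1) (x e.2)

/-- `H` is quasirandom-forcing: every tournamenton `W` with `t(H, W) = 2^{-‖H‖}` is equal to `1/2`
almost everywhere. -/
def QuasirandomForcing {V : Type*} [Fintype V] (H : OrientedGraph V) : Prop :=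
  ∀ W : I → I → ℝ, IsTournamenton W → H.homDensity W = 1 / 2 ^ H.edges.card →
    ∀ᵐ p : I × I, W p.1 p.2 = 1 / 2

open Classical in
/-- The `k`-tuples of integers `1 ≤ n_1 ≤ ⋯ ≤ n_k` with `6 < k + 2 n_1 + ⋯ + 2 n_k ≤ ℓ`. -/
noncomputable def tuples (ℓ k : ℕ) : Finset (Fin k → ℕ) :=
  (Fintype.piFinset fun _ : Fin k => Finset.Icc 1 ℓ).filter fun n =>
    Monotone n ∧ 6 < k + ∑ i, 2 * n i ∧ k + ∑ i, 2 * n i ≤ ℓ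

end OrientedGraph

/-! Write `W = (1 + A) / 2` with `A` antisymmetric and `|A| ≤ 1`, and expand the product defining
`t(C, W)` over edge subsets `F` of `C`. The empty set contributes 1. The full set contributes `γ_C ·
t(D_ℓ, A)`, because reversing an edge changes the sign of a density in `A`. Every other `F` is a
disjoint union of paths and isolated vertices. A path with an odd number of edges has density 0, by
reversing all its edges. If all the paths have even length, the density is plus or minus the product
of the `t(Q_{2n_i}, A)`, with the sign counted by `α_C`. Hence `2^ℓ t(C, W) = 1 + γ_C t(D_ℓ, A) + ∑
α_C(2n_1, …) ∏ t(Q_{2n_i}, A)`.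

Let `T` be the integral operator of `A`; it is skew-adjoint. Therefore `t(Q_{2n}, A) = ‖T^n 1‖²`,
and `t(D_ℓ, A)` is an integral of squares as well; both are nonnegative. Two estimates carry the
numerical part: `‖T‖ ≤ 2/π` (`integral_kernelOp_sq_le`), which gives `t(Q_{2n}, A) ≤ (4/π²)^(n-1)
t(Q_2, A)`, and `t(Q_2, A) ≤ 1/3` (`pathNorm_one_le`). With them the two hypotheses say that the
one-path terms, compared with `t(Q_2, A)`, and the terms with several paths, compared with `t(Q_2,
A)²`, each have a sum whose sign agrees with `γ_C`.

If now `t(C, W) = 2^{-ℓ}`, then `γ_C t(D_ℓ, A)` and a quantity of the same weak sign add up to 0. So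
`t(D_ℓ, A) = 0`, and this forces `A = 0` almost everywhere (`ae_eq_zero_of_cycleNorm`). -/

namespace OrientedGraph

/-! ### Kernels, bounded functions and integral operators -/

/-- A bounded measurable function on the unit interval. -/
def IsBddMeas (f : I → ℝ) : Prop :=
  Measurable f ∧ ∃ M : ℝ, ∀ x, |f x| ≤ M

/-- The integral operator with kernel `A`. -/
noncomputable def kernelOp (A : I → I → ℝ) (f : I → ℝ) : I → ℝ := fun x => ∫ y, A x y * f y

theorem integrable_of_abs_le {α : Type*} [MeasurableSpace α] {μ : Measure α} [IsFiniteMeasure μ]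
    {f : α → ℝ} (hf : Measurable f) {M : ℝ} (hM : ∀ x, |f x| ≤ M) : Integrable f μ :=
  Integrable.of_bound hf.aestronglyMeasurable M (Filter.Eventually.of_forall hM)

theorem abs_integral_le_of_abs_le {α : Type*} [MeasurableSpace α] {μ : Measure α}
    [IsProbabilityMeasure μ] {f : α → ℝ} {M : ℝ} (hM : ∀ x, |f x| ≤ M) : |∫ x, f x ∂μ| ≤ M := by
  have h := norm_integral_le_of_norm_le_const (μ := μ) (f := f) (C := M)
    (Filter.Eventually.of_forall hM)
  simpa using h

theorem IsBddMeas.integrable {f : I → ℝ} (hf : IsBddMeas f) : Integrable f := by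
  obtain ⟨h, M, hM⟩ := hf
  exact integrable_of_abs_le h hM

theorem isBddMeas_const (c : ℝ) : IsBddMeas fun _ => c := ⟨measurable_const, |c|, fun _ => le_rfl⟩

theorem abs_mul_le_of_abs_le {a b M N : ℝ} (ha : |a| ≤ M) (hb : |b| ≤ N) : |a * b| ≤ M * N := by
  rw [abs_mul]
  exact mul_le_mul ha hb (abs_nonneg _) ((abs_nonneg _).trans ha)

theorem IsBddMeas.mul {f g : I → ℝ} (hf : IsBddMeas f) (hg : IsBddMeas g) :
    IsBddMeas fun x => f x * g x := by
  obtain ⟨h, M, hM⟩ := hf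
  obtain ⟨h', N, hN⟩ := hg
  exact ⟨h.mul h', M * N, fun x => abs_mul_le_of_abs_le (hM x) (hN x)⟩

theorem IsKernel.mul {A B : I → I → ℝ} (hA : IsKernel A) (hB : IsKernel B) :
    IsKernel fun x y => A x y * B x y := by
  obtain ⟨h, M, hM⟩ := hA
  obtain ⟨h', N, hN⟩ := hB
  exact ⟨h.mul h', M * N, fun x y => abs_mul_le_of_abs_le (hM x y) (hN x y)⟩

theorem IsKernel.swap {A : I → I → ℝ} (hA : IsKernel A) : IsKernel fun x y => A y x := by
  obtain ⟨h, M, hM⟩ := hA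
  exact ⟨h.comp measurable_swap, M, fun x y => hM y x⟩

theorem IsBddMeas.kernel_fst {f : I → ℝ} (hf : IsBddMeas f) : IsKernel fun x _ => f x := by
  obtain ⟨h, M, hM⟩ := hf
  exact ⟨h.comp measurable_fst, M, fun x _ => hM x⟩

theorem IsBddMeas.kernel_snd {f : I → ℝ} (hf : IsBddMeas f) : IsKernel fun _ y => f y :=
  hf.kernel_fst.swap

theorem IsKernel.section {A : I → I → ℝ} (hA : IsKernel A) (x : I) : IsBddMeas (A x) := by
  obtain ⟨h, M, hM⟩ := hA
  exact ⟨h.comp measurable_prodMk_left, M, fun y => hM x y⟩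

theorem IsKernel.integrable {A : I → I → ℝ} (hA : IsKernel A) :
    Integrable fun p : I × I => A p.1 p.2 := by
  obtain ⟨h, M, hM⟩ := hA
  exact integrable_of_abs_le h fun p => hM p.1 p.2

theorem IsKernel.integral_eq {A : I → I → ℝ} (hA : IsKernel A) :
    ∫ p : I × I, A p.1 p.2 = ∫ x, ∫ y, A x y := by
  rw [Measure.volume_eq_prod]
  exact integral_prod (fun p : I × I => A p.1 p.2) hA.integrable

theorem IsKernel.integral_eq_symm {A : I → I → ℝ} (hA : IsKernel A) :
    ∫ p : I × I, A p.1 p.2 = ∫ y, ∫ x, A x y := by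
  rw [Measure.volume_eq_prod]
  exact integral_prod_symm (fun p : I × I => A p.1 p.2) hA.integrable

theorem integral_add_add {α : Type*} [MeasurableSpace α] {μ : Measure α} {f g h : α → ℝ}
    (hf : Integrable f μ) (hg : Integrable g μ) (hh : Integrable h μ) :
    ∫ x, (f x + g x + h x) ∂μ = (∫ x, f x ∂μ) + (∫ x, g x ∂μ) + ∫ x, h x ∂μ := by
  rw [← integral_add hf hg]
  exact integral_add (hf.add hg) hh

theorem IsKernel.integral {A : I → I → ℝ} (hA : IsKernel A) : IsBddMeas fun x => ∫ y, A x y := by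
  obtain ⟨h, M, hM⟩ := hA
  refine ⟨(h.stronglyMeasurable.integral_prod_right (ν := volume)).measurable, M,
    fun x => abs_integral_le_of_abs_le fun y => hM x y⟩

theorem IsKernel.kernelOp {A H : I → I → ℝ} (hA : IsKernel A) (hH : IsKernel H) :
    IsKernel fun a => kernelOp A (H a) := by
  obtain ⟨h, M, hM⟩ := hA
  obtain ⟨h', N, hN⟩ := hH
  refine ⟨?_, M * N, fun x y => abs_integral_le_of_abs_le fun c =>
    abs_mul_le_of_abs_le (hM y c) (hN x c)⟩
  have : Measurable fun q : (I × I) × I => A q.1.2 q.2 * H q.1.1 q.2 :=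
    (h.comp (by fun_prop : Measurable fun q : (I × I) × I => (q.1.2, q.2))).mul
      (h'.comp (by fun_prop : Measurable fun q : (I × I) × I => (q.1.1, q.2)))
  exact (this.stronglyMeasurable.integral_prod_right' (ν := volume)).measurable

theorem IsBddMeas.kernelOp {A : I → I → ℝ} {f : I → ℝ} (hA : IsKernel A) (hf : IsBddMeas f) :
    IsBddMeas (kernelOp A f) :=
  (hA.mul hf.kernel_snd).integral

theorem IsBddMeas.kernelOp_iterate {A : I → I → ℝ} {f : I → ℝ} (hA : IsKernel A)
    (hf : IsBddMeas f) (n : ℕ) : IsBddMeas ((OrientedGraph.kernelOp A)^[n] f) := by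
  induction n generalizing f with
  | zero => exact hf
  | succ n ih => exact ih (hf.kernelOp hA)

theorem IsKernel.kernelOp_iterate {A H : I → I → ℝ} (hA : IsKernel A) (hH : IsKernel H) (n : ℕ) :
    IsKernel fun a => (OrientedGraph.kernelOp A)^[n] (H a) := by
  induction n generalizing H with
  | zero => exact hH
  | succ n ih => exact ih (hA.kernelOp hH)

theorem integral_mul_kernelOp {A : I → I → ℝ} (hA : IsKernel A) (hanti : ∀ x y, A x y = -A y x)
    {f g : I → ℝ} (hf : IsBddMeas f) (hg : IsBddMeas g) :
    ∫ x, f x * kernelOp A g x = -∫ x, kernelOp A f x * g x := by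
  have h : IsKernel fun x y => f x * (A x y * g y) := hf.kernel_fst.mul (hA.mul hg.kernel_snd)
  calc ∫ x, f x * kernelOp A g x = ∫ x, ∫ y, f x * (A x y * g y) := by
        simp only [kernelOp, integral_const_mul]
    _ = ∫ y, ∫ x, f x * (A x y * g y) := integral_integral_swap h.integrable
    _ = -∫ x, kernelOp A f x * g x := by
        rw [← integral_neg]
        congr 1 with y
        rw [kernelOp, ← integral_mul_const, ← integral_neg]
        congr 1 with x
        rw [hanti x y]
        ring

theorem integral_mul_kernelOp_iterate {A : I → I → ℝ} (hA : IsKernel A)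
    (hanti : ∀ x y, A x y = -A y x) {f g : I → ℝ} (hf : IsBddMeas f) (hg : IsBddMeas g) (n : ℕ) :
    ∫ x, f x * (kernelOp A)^[n] g x = (-1) ^ n * ∫ x, (kernelOp A)^[n] f x * g x := by
  induction n generalizing f with
  | zero => simp
  | succ n ih =>
    rw [Function.iterate_succ_apply', integral_mul_kernelOp hA hanti hf (hg.kernelOp_iterate hA n),
      ih (hf.kernelOp hA), Function.iterate_succ_apply]
    ring

theorem IsKernel.measurable_eval {A : I → I → ℝ} (hA : IsKernel A) {V : Type*} (u v : V) :
    Measurable fun x : V → I => A (x u) (x v) :=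
  hA.1.comp (by fun_prop : Measurable fun x : V → I => (x u, x v))

/-- Integrating a product of kernel values along a path amounts to iterating the operator. -/
theorem integral_path {A : I → I → ℝ} (hA : IsKernel A) (m : ℕ) {H : I → I → ℝ}
    (hH : IsKernel H) :
    ∫ x : Fin (m + 1) → I, (∏ i : Fin m, A (x i.castSucc) (x i.succ)) * H (x 0) (x (Fin.last m)) =
      ∫ a, (kernelOp A)^[m] (H a) a := by
  induction m generalizing H with
  | zero =>
    simp only [Finset.univ_eq_empty, Finset.prod_empty, one_mul, Function.iterate_zero, id]
    exact (volume_preserving_funUnique (Fin 1) I).integral_comp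
      (MeasurableEquiv.measurableEmbedding _) fun a => H a a
  | succ m ih =>
    rw [show (∫ a, (kernelOp A)^[m + 1] (H a) a) = ∫ a, (kernelOp A)^[m] (kernelOp A (H a)) a from
      rfl, ← ih (hA.kernelOp hH)]
    -- The last vertex is integrated out first: its edge and `H` merge into the kernel `(a, b) ↦
    -- kernelOp A (H a) b`, on a path one edge shorter.
    have e := (volume_preserving_piFinSuccAbove (fun _ : Fin (m + 2) => I) (Fin.last (m + 1))).symm
    rw [← e.integral_comp', Measure.volume_eq_prod, integral_prod_symm]
    · congr 1 with y
      rw [kernelOp, ← integral_const_mul]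
      congr 1 with b
      simp only [MeasurableEquiv.piFinSuccAbove_symm_apply, Fin.insertNthEquiv,
        Equiv.coe_fn_mk, Fin.prod_univ_castSucc, Fin.insertNth_last']
      simp only [← Fin.castSucc_succ, Fin.snoc_castSucc, Fin.succ_last, Fin.snoc_last,
        ← Fin.castSucc_zero]
      ring
    · have hm : Measurable fun x : Fin (m + 2) → I =>
          (∏ i : Fin (m + 1), A (x i.castSucc) (x i.succ)) * H (x 0) (x (Fin.last (m + 1))) :=
        (Finset.measurable_prod _ fun i _ => hA.measurable_eval _ _).mul (hH.measurable_eval _ _)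
      obtain ⟨-, M, hM⟩ := hA
      obtain ⟨-, N, hN⟩ := hH
      refine integrable_of_abs_le (M := (∏ _i : Fin (m + 1), M) * N) (hm.comp e.measurable)
        fun p => abs_mul_le_of_abs_le ?_ (hN _ _)
      rw [Finset.abs_prod]
      exact Finset.prod_le_prod (fun _ _ => abs_nonneg _) fun i _ => hM _ _

/-! ### The operator norm bound `2/π` -/

theorem integral_exp_mul_sin (n : ℤ) :
    ∫ x in (0 : ℝ)..Real.pi, Complex.exp (-(2 * n * x) * Complex.I) * (Real.sin x : ℂ) =
      2 / (1 - 4 * (n : ℂ) ^ 2) := by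
  have hne : (1 - 4 * (n : ℂ) ^ 2) ≠ 0 := by
    have : (1 - 4 * n ^ 2 : ℤ) ≠ 0 := by omega
    exact_mod_cast this
  have hd : ∀ x ∈ Set.uIcc (0 : ℝ) Real.pi, HasDerivAt (fun x : ℝ =>
      Complex.exp (-(2 * n * x) * Complex.I) *
        (-(2 * n) * Complex.I * (Real.sin x : ℂ) - (Real.cos x : ℂ)) / (1 - 4 * (n : ℂ) ^ 2))
      (Complex.exp (-(2 * n * x) * Complex.I) * (Real.sin x : ℂ)) x := by
    intro x _
    have hx : HasDerivAt (fun x : ℝ => (x : ℂ)) 1 x := Complex.ofRealCLM.hasDerivAt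
    have h1 : HasDerivAt (fun x : ℝ => Complex.exp (-(2 * n * x) * Complex.I))
        (Complex.exp (-(2 * n * x) * Complex.I) * (-(2 * n * 1) * Complex.I)) x :=
      (((hx.const_mul (2 * (n : ℂ))).neg).mul_const Complex.I).cexp
    have h2 : HasDerivAt (fun x : ℝ => (Real.sin x : ℂ)) (Real.cos x : ℂ) x :=
      (Real.hasDerivAt_sin x).ofReal_comp
    have h3 : HasDerivAt (fun x : ℝ => (Real.cos x : ℂ)) ((-Real.sin x : ℝ) : ℂ) x :=
      (Real.hasDerivAt_cos x).ofReal_comp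
    refine ((h1.mul ((h2.const_mul (-(2 * n) * Complex.I)).sub h3)).div_const _).congr_deriv ?_
    rw [div_eq_iff hne]
    simp only [Pi.sub_apply]
    push_cast
    linear_combination (4 * (n : ℂ) ^ 2 * Complex.exp (-(2 * n * x) * Complex.I) * Complex.sin x) *
      Complex.I_sq
  rw [intervalIntegral.integral_eq_sub_of_hasDerivAt hd
    (Continuous.intervalIntegrable (by fun_prop) _ _)]
  have h1 : Complex.exp (-(2 * n * (Real.pi : ℂ)) * Complex.I) = 1 := by
    rw [Complex.exp_eq_one_iff]
    exact ⟨-n, by push_cast; ring⟩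
  rw [h1]
  simp
  ring

/-- The Fourier series of the `π`-periodic function `|sin|`. What matters later is that only the
coefficient at `n = 0` is positive. -/
theorem hasSum_abs_sin (θ : ℝ) :
    HasSum (fun n : ℤ => (((2 / Real.pi) / (1 - 4 * (n : ℝ) ^ 2) : ℝ) : ℂ) *
      Complex.exp (2 * n * θ * Complex.I)) (|Real.sin θ| : ℝ) := by
  have : Fact (0 < Real.pi) := ⟨Real.pi_pos⟩
  have hper : Function.Periodic (fun x : ℝ => ((|Real.sin x| : ℝ) : ℂ)) Real.pi := fun x => by
    simp [Real.sin_add_pi]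
  let f : C(AddCircle Real.pi, ℂ) := ⟨hper.lift, continuous_coinduced_dom.mpr (by
    change Continuous fun x : ℝ => ((|Real.sin x| : ℝ) : ℂ)
    fun_prop)⟩
  have hf : ∀ x : ℝ, f (x : AddCircle Real.pi) = (|Real.sin x| : ℝ) := fun x => rfl
  have hc : ∀ n : ℤ, fourierCoeff f n = (((2 / Real.pi) / (1 - 4 * (n : ℝ) ^ 2) : ℝ) : ℂ) := by
    intro n
    rw [fourierCoeff_eq_intervalIntegral f n 0, zero_add]
    have : ∫ x in (0 : ℝ)..Real.pi, (fourier (-n) (x : AddCircle Real.pi) : ℂ) •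
        f (x : AddCircle Real.pi) = ∫ x in (0 : ℝ)..Real.pi,
          Complex.exp (-(2 * n * x) * Complex.I) * (Real.sin x : ℂ) := by
      refine intervalIntegral.integral_congr fun x hx => ?_
      rw [Set.uIcc_of_le Real.pi_pos.le] at hx
      simp only [hf, fourier_coe_apply, smul_eq_mul,
        abs_of_nonneg (Real.sin_nonneg_of_nonneg_of_le_pi hx.1 hx.2)]
      congr 2
      have : (Real.pi : ℂ) ≠ 0 := by exact_mod_cast Real.pi_ne_zero
      field_simp
      push_cast
      ring
    rw [this, integral_exp_mul_sin, Complex.real_smul]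
    push_cast
    ring
  have hs : Summable (fourierCoeff f) := by
    have h2 : Summable fun n : ℤ => (2 / Real.pi) * |1 / (n : ℝ) ^ 2| :=
      ((Real.summable_one_div_int_pow.mpr one_lt_two).abs).mul_left _
    -- The comparison fails at `n = 0`, where `1 / 0 ^ 2` is 0 by convention, so that index is
    -- excluded.
    refine Summable.of_norm_bounded_eventually h2 ?_
    have : {n : ℤ | ¬‖fourierCoeff f n‖ ≤ (2 / Real.pi) * |1 / (n : ℝ) ^ 2|} ⊆ {0} := by
      intro n hn
      by_contra h0
      refine hn ?_
      rw [hc, Complex.norm_real, Real.norm_eq_abs, div_eq_mul_one_div, abs_mul,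
        abs_of_pos (by positivity : 0 < 2 / Real.pi)]
      have hn1 : (1 : ℝ) ≤ (n : ℝ) ^ 2 := by
        have : (1 : ℤ) ≤ n ^ 2 := by
          have : 0 < n ^ 2 := by
            have : n ≠ 0 := h0
            positivity
          omega
        exact_mod_cast this
      refine mul_le_mul_of_nonneg_left ?_ (by positivity)
      rw [abs_div, abs_div, abs_one, abs_of_nonneg (sq_nonneg (n : ℝ)),
        abs_of_neg (by linarith : 1 - 4 * (n : ℝ) ^ 2 < 0)]
      exact one_div_le_one_div_of_le (by linarith) (by linarith)
    exact (Set.finite_singleton 0).subset this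
  have h := has_pointwise_sum_fourier_series_of_summable hs (θ : AddCircle Real.pi)
  rw [hf] at h
  convert h using 2 with n
  rw [hc, smul_eq_mul, fourier_coe_apply]
  congr 2
  have : (Real.pi : ℂ) ≠ 0 := by exact_mod_cast Real.pi_ne_zero
  field_simp

theorem sq_integral_le {α : Type*} [MeasurableSpace α] {μ : Measure α} [IsProbabilityMeasure μ]
    {r : α → ℝ} (hr : Integrable r μ) (hr2 : Integrable (fun x => r x ^ 2) μ) :
    (∫ x, r x ∂μ) ^ 2 ≤ ∫ x, r x ^ 2 ∂μ := by
  set m := ∫ x, r x ∂μ with hm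
  have h : 0 ≤ ∫ x, (r x - m) ^ 2 ∂μ := integral_nonneg fun x => sq_nonneg _
  have e : ∫ x, (r x - m) ^ 2 ∂μ = ∫ x, (r x ^ 2 - 2 * m * r x) + m ^ 2 ∂μ := by
    congr 1 with x; ring
  have e2 : ∫ x, (r x ^ 2 - 2 * m * r x) + m ^ 2 ∂μ =
      (∫ x, (r x ^ 2 - 2 * m * r x) ∂μ) + ∫ _, m ^ 2 ∂μ :=
    integral_add (hr2.sub (hr.const_mul _)) (integrable_const _)
  rw [e, e2, integral_sub hr2 (hr.const_mul _), integral_const_mul, ← hm] at h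
  simp only [integral_const, probReal_univ, one_smul] at h
  nlinarith

theorem abs_cross_eq (z w : ℂ) : |z.re * w.im - z.im * w.re| =
    ‖z‖ * ‖w‖ * |Real.sin (z.arg - w.arg)| := by
  have h : z.re * w.im - z.im * w.re = ‖z‖ * ‖w‖ * -Real.sin (z.arg - w.arg) := by
    rw [Real.sin_sub]
    nth_rewrite 1 [← Complex.norm_mul_cos_arg z, ← Complex.norm_mul_sin_arg z,
      ← Complex.norm_mul_cos_arg w, ← Complex.norm_mul_sin_arg w]
    ring
  rw [h, abs_mul, abs_neg, abs_of_nonneg (mul_nonneg (norm_nonneg z) (norm_nonneg w))]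

/-- With `z = f + i g`, the integrand is `|z(x)| |z(y)| |sin(arg z(x) - arg z(y))|`. In the Fourier
series of `|sin|` the `n`-th term separates the variables and integrates to `c n * ‖∫ w n‖²`. All
terms with `n ≠ 0` are nonpositive, and the zeroth is at most `(2/π) (∫ |z|)² ≤ (2/π) ∫ |z|²`. -/
theorem integral_abs_cross_le {f g : I → ℝ} (hf : IsBddMeas f) (hg : IsBddMeas g) :
    ∫ p : I × I, |f p.1 * g p.2 - g p.1 * f p.2| ≤
      (2 / Real.pi) * ((∫ x, f x ^ 2) + ∫ x, g x ^ 2) := by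
  obtain ⟨hfm, M, hM⟩ := hf
  obtain ⟨hgm, N, hN⟩ := hg
  let z : I → ℂ := fun x => ⟨f x, g x⟩
  have hz : Measurable z := by
    have : z = fun x => (f x : ℂ) + (g x : ℂ) * Complex.I := by
      ext x; exact Complex.mk_eq_add_mul_I _ _
    rw [this]; fun_prop
  have hzle : ∀ x, ‖z x‖ ≤ M + N := fun x =>
    (Complex.norm_le_abs_re_add_abs_im (z x)).trans (add_le_add (hM x) (hN x))
  let c : ℤ → ℝ := fun n => (2 / Real.pi) / (1 - 4 * (n : ℝ) ^ 2)
  let w : ℤ → I → ℂ := fun n x => ‖z x‖ * Complex.exp (2 * n * (z x).arg * Complex.I)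
  have hwn : ∀ n x, ‖w n x‖ = ‖z x‖ := fun n x => by
    have : (2 * n * (z x).arg * Complex.I : ℂ) = ((2 * n * (z x).arg : ℝ) : ℂ) * Complex.I := by
      push_cast; ring
    simp only [w]
    rw [norm_mul, this, Complex.norm_exp_ofReal_mul_I, mul_one, Complex.norm_real, norm_norm]
  have hwm : ∀ n, Measurable (w n) := fun n => by
    have := Complex.measurable_arg.comp hz
    have h2 : Measurable fun x => (z x).arg := this
    fun_prop
  have hwi : ∀ n, Integrable (w n) := fun n =>
    Integrable.of_bound (hwm n).aestronglyMeasurable (M + N)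
      (Filter.Eventually.of_forall fun x => (hwn n x).le.trans (hzle x))
  let F : ℤ → I × I → ℂ := fun n p => (c n : ℂ) * (w n p.1 * (starRingEnd ℂ) (w n p.2))
  have hwc : ∀ n, Integrable fun y => (starRingEnd ℂ) (w n y) := fun n =>
    Complex.conjCLE.toContinuousLinearMap.integrable_comp (hwi n)
  have hFi : ∀ n, Integrable (F n) := fun n => ((hwi n).mul_prod (hwc n)).const_mul _
  have hFsum : ∀ p : I × I, HasSum (fun n => F n p)
      ((|f p.1 * g p.2 - g p.1 * f p.2| : ℝ) : ℂ) := by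
    intro p
    have h := (hasSum_abs_sin ((z p.1).arg - (z p.2).arg)).mul_left
      ((‖z p.1‖ * ‖z p.2‖ : ℝ) : ℂ)
    rw [← Complex.ofReal_mul, ← abs_cross_eq] at h
    refine (congrArg (HasSum · _) (funext fun n => ?_)).mpr h
    simp only [F, w, map_mul, Complex.conj_ofReal, ← Complex.exp_conj, Complex.conj_I,
      map_intCast, map_ofNat]
    push_cast
    have : Complex.exp (2 * n * ((z p.1).arg - (z p.2).arg) * Complex.I) =
        Complex.exp (2 * n * (z p.1).arg * Complex.I) *
          Complex.exp (2 * n * (z p.2).arg * -Complex.I) := by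
      rw [← Complex.exp_add]; congr 1; ring
    rw [this]
    simp only [c]
    push_cast
    ring
  have hcs : Summable fun n => |c n| := by
    have := (hasSum_abs_sin 0).summable.norm
    simpa only [c, Complex.ofReal_zero, mul_zero, zero_mul, Complex.exp_zero, mul_one,
      Complex.norm_real, Real.norm_eq_abs] using this
  have hS : Summable fun n => ∫ p, ‖F n p‖ := by
    refine Summable.of_nonneg_of_le (fun n => integral_nonneg fun p => norm_nonneg _) (fun n => ?_)
      (hcs.mul_right ((M + N) * (M + N)))
    have hb : ∀ p, |‖F n p‖| ≤ |c n| * ((M + N) * (M + N)) := fun p => by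
      rw [abs_norm]
      simp only [F, norm_mul, Complex.norm_real, Real.norm_eq_abs, RCLike.norm_conj, hwn]
      have := hzle p.1
      have := hzle p.2
      have := norm_nonneg (z p.1)
      gcongr
      linarith
    exact (le_abs_self _).trans (abs_integral_le_of_abs_le hb)
  have h1 := hasSum_integral_of_summable_integral_norm hFi hS
  have h2 : ∀ n, ∫ p, F n p = ((c n * ‖∫ x, w n x‖ ^ 2 : ℝ) : ℂ) := fun n => by
    simp only [F]
    rw [integral_const_mul, Measure.volume_eq_prod,
      integral_prod_mul (w n) fun y => (starRingEnd ℂ) (w n y), integral_conj, Complex.mul_conj,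
      Complex.normSq_eq_norm_sq]
    push_cast
    ring
  simp only [h2, (hFsum _).tsum_eq, integral_complex_ofReal] at h1
  have h3 : HasSum (fun n => c n * ‖∫ x, w n x‖ ^ 2)
      (∫ p : I × I, |f p.1 * g p.2 - g p.1 * f p.2|) := by exact_mod_cast h1
  -- Comparison with the series that keeps only the term `n = 0`.
  have h4 := hasSum_le (fun n => ?_) h3 (hasSum_ite_eq 0 (c 0 * ‖∫ x, w 0 x‖ ^ 2))
  · refine h4.trans ?_
    have hc0 : c 0 = 2 / Real.pi := by simp [c]
    have hw0 : ‖∫ x, w 0 x‖ ≤ ∫ x, ‖z x‖ := by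
      refine (norm_integral_le_integral_norm _).trans_eq ?_
      simp only [hwn]
    have hzi : Integrable fun x => ‖z x‖ :=
      integrable_of_abs_le hz.norm fun x => by simpa using hzle x
    have hf2 : Integrable fun x => f x ^ 2 := integrable_of_abs_le (M := M ^ 2) (by fun_prop)
      fun x => by rw [abs_pow]; exact pow_le_pow_left₀ (abs_nonneg _) (hM x) 2
    have hg2 : Integrable fun x => g x ^ 2 := integrable_of_abs_le (M := N ^ 2) (by fun_prop)
      fun x => by rw [abs_pow]; exact pow_le_pow_left₀ (abs_nonneg _) (hN x) 2
    have hz2 : (fun x => ‖z x‖ ^ 2) = fun x => f x ^ 2 + g x ^ 2 := by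
      ext x
      rw [← Complex.normSq_eq_norm_sq, Complex.normSq_mk]
      ring
    rw [hc0, ← integral_add hf2 hg2, ← hz2]
    gcongr
    exact (pow_le_pow_left₀ (norm_nonneg _) hw0 2).trans
      (sq_integral_le hzi (hz2 ▸ hf2.add hg2))
  · split_ifs with h
    · rw [h]
    · refine mul_nonpos_of_nonpos_of_nonneg ?_ (by positivity)
      refine div_nonpos_of_nonneg_of_nonpos (by positivity) ?_
      have : (1 : ℤ) ≤ n ^ 2 := by
        have : 0 < n ^ 2 := by positivity
        omega
      have : (1 : ℝ) ≤ (n : ℝ) ^ 2 := by exact_mod_cast this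
      linarith

theorem IsBddMeas.const_mul {f : I → ℝ} (hf : IsBddMeas f) (c : ℝ) : IsBddMeas fun x => c * f x :=
  (isBddMeas_const c).mul hf

theorem integral_mul_kernelOp_eq {A : I → I → ℝ} (hA : IsKernel A) {f g : I → ℝ}
    (hf : IsBddMeas f) (hg : IsBddMeas g) :
    ∫ x, f x * kernelOp A g x = ∫ p : I × I, f p.1 * (A p.1 p.2 * g p.2) := by
  have h : IsKernel fun x y => f x * (A x y * g y) := hf.kernel_fst.mul (hA.mul hg.kernel_snd)
  rw [h.integral_eq]
  simp only [kernelOp, integral_const_mul]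

/-- Antisymmetry turns `2 ⟨f, T g⟩` into an integral of `A(x, y)` against `f(x) g(y) - g(x) f(y)`,
and `|A| ≤ 1` leaves the integral of the absolute value bounded above. -/
theorem integral_kernelOp_sq_le {A : I → I → ℝ} (hA : IsKernel A) (hanti : ∀ x y, A x y = -A y x)
    (hA1 : ∀ x y, |A x y| ≤ 1) {g : I → ℝ} (hg : IsBddMeas g) :
    ∫ x, kernelOp A g x ^ 2 ≤ (4 / Real.pi ^ 2) * ∫ x, g x ^ 2 := by
  have key : ∀ f : I → ℝ, IsBddMeas f →
      ∫ x, f x * kernelOp A g x ≤ (1 / Real.pi) * ((∫ x, f x ^ 2) + ∫ x, g x ^ 2) := by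
    intro f hf
    have h1 : IsKernel fun x y => f x * (A x y * g y) := hf.kernel_fst.mul (hA.mul hg.kernel_snd)
    have h2 : IsKernel fun x y => g x * (A x y * f y) := hg.kernel_fst.mul (hA.mul hf.kernel_snd)
    have h3 : IsKernel fun x y => f x * g y := hf.kernel_fst.mul hg.kernel_snd
    have h4 : IsKernel fun x y => g x * f y := hg.kernel_fst.mul hf.kernel_snd
    have e1 := integral_mul_kernelOp_eq hA hf hg
    have e2 := integral_mul_kernelOp_eq hA hg hf
    have e3 := integral_mul_kernelOp hA hanti hf hg
    have e4 : ∫ x, kernelOp A f x * g x = ∫ x, g x * kernelOp A f x := by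
      simp only [mul_comm]
    have e5 : 2 * ∫ x, f x * kernelOp A g x ≤
        ∫ p : I × I, |f p.1 * g p.2 - g p.1 * f p.2| := by
      calc 2 * ∫ x, f x * kernelOp A g x
          = (∫ x, f x * kernelOp A g x) - ∫ x, g x * kernelOp A f x := by rw [← e4]; linarith
        _ = ∫ p : I × I, (f p.1 * (A p.1 p.2 * g p.2) - g p.1 * (A p.1 p.2 * f p.2)) := by
          rw [e1, e2]
          exact (integral_sub h1.integrable h2.integrable).symm
        _ ≤ _ := by
          refine integral_mono (h1.integrable.sub h2.integrable)
            (h3.integrable.sub h4.integrable).abs fun p => ?_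
          calc f p.1 * (A p.1 p.2 * g p.2) - g p.1 * (A p.1 p.2 * f p.2)
              = A p.1 p.2 * (f p.1 * g p.2 - g p.1 * f p.2) := by ring
            _ ≤ |A p.1 p.2| * |f p.1 * g p.2 - g p.1 * f p.2| := by
              rw [← abs_mul]; exact le_abs_self _
            _ ≤ 1 * |f p.1 * g p.2 - g p.1 * f p.2| := by
              gcongr
              exact hA1 _ _
            _ = _ := one_mul _
    have e6 := integral_abs_cross_le hf hg
    have : (2 / Real.pi) = 2 * (1 / Real.pi) := by ring
    rw [this] at e6
    linarith
  -- The scaling `π/2` is the optimal one: the resulting inequality is `(π/2) ‖T g‖² ≤ (π/4) ‖T g‖²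
  -- + (1/π) ‖g‖²`.
  have h := key _ ((hg.kernelOp hA).const_mul (Real.pi / 2))
  have e1 : ∫ x, Real.pi / 2 * kernelOp A g x * kernelOp A g x =
      Real.pi / 2 * ∫ x, kernelOp A g x ^ 2 := by
    rw [← integral_const_mul]; congr 1 with x; ring
  have e2 : ∫ x, (Real.pi / 2 * kernelOp A g x) ^ 2 =
      (Real.pi / 2) ^ 2 * ∫ x, kernelOp A g x ^ 2 := by
    rw [← integral_const_mul]; congr 1 with x; ring
  rw [e1, e2] at h
  have hpi := Real.pi_pos
  rw [one_div, ← div_eq_inv_mul, le_div_iff₀ hpi] at h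
  rw [div_mul_eq_mul_div, le_div_iff₀ (by positivity)]
  linarith

/-! ### Bounds on path densities -/

/-- The density of the path with `2 n` edges directed from the centre to the ends. -/
noncomputable def pathNorm (A : I → I → ℝ) (n : ℕ) : ℝ :=
  ∫ x, (kernelOp A)^[n] (fun _ => 1) x ^ 2

theorem pathNorm_nonneg (A : I → I → ℝ) (n : ℕ) : 0 ≤ pathNorm A n :=
  integral_nonneg fun _ => sq_nonneg _

theorem pathNorm_succ_le {A : I → I → ℝ} (hA : IsKernel A) (hanti : ∀ x y, A x y = -A y x)
    (hA1 : ∀ x y, |A x y| ≤ 1) (n : ℕ) :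
    pathNorm A (n + 1) ≤ (4 / Real.pi ^ 2) ^ n * pathNorm A 1 := by
  induction n with
  | zero => simp
  | succ n ih =>
    have h := integral_kernelOp_sq_le hA hanti hA1
      ((isBddMeas_const 1).kernelOp_iterate hA (n + 1))
    simp only [← Function.iterate_succ_apply' (kernelOp A)] at h
    calc pathNorm A (n + 1 + 1) ≤ (4 / Real.pi ^ 2) * pathNorm A (n + 1) := h
      _ ≤ (4 / Real.pi ^ 2) * ((4 / Real.pi ^ 2) ^ n * pathNorm A 1) := by gcongr
      _ = _ := by ring

theorem neg_mul_add_mul_add_mul_le_one {a b c : ℝ} (ha : |a| ≤ 1) (hb : |b| ≤ 1) (hc : |c| ≤ 1) :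
    -(a * b + b * c + c * a) ≤ 1 := by
  rw [abs_le] at *
  -- `(1-a)(1-b)(1-c) + (1+a)(1+b)(1+c) = 2 + 2(ab + bc + ca)`, and both products are nonnegative.
  nlinarith [mul_nonneg (mul_nonneg (sub_nonneg.2 ha.2) (sub_nonneg.2 hb.2)) (sub_nonneg.2 hc.2),
    mul_nonneg (mul_nonneg (by linarith : 0 ≤ a + 1) (by linarith : 0 ≤ b + 1))
      (by linarith : 0 ≤ c + 1)]

/-- Apply the preceding inequality to `A(x,y)`, `A(y,z)`, `A(z,x)` and integrate over the triple:
each of the three products, with its minus sign, is a copy of `Q_2` centred at one of the points, so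
`3 * pathNorm A 1 ≤ 1`. -/
theorem pathNorm_one_le {A : I → I → ℝ} (hA : IsKernel A) (hanti : ∀ x y, A x y = -A y x)
    (hA1 : ∀ x y, |A x y| ≤ 1) : pathNorm A 1 ≤ 1 / 3 := by
  set u := kernelOp A fun _ => 1 with hu
  have hub : IsBddMeas u := (isBddMeas_const 1).kernelOp hA
  have hux : ∀ x, ∫ y, A x y = u x := fun x => by simp [hu, kernelOp]
  have h1 : IsKernel fun x y => A x y * u x := hA.mul hub.kernel_fst
  have h2 : IsKernel fun x y => A y x * u y := hA.swap.mul hub.kernel_snd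
  have h3 : IsKernel fun x y => kernelOp A (A y) x := (hA.kernelOp hA).swap
  have hq : pathNorm A 1 = ∫ x, u x * u x := by
    simp only [pathNorm, Function.iterate_one, sq, hu]
  have huu : ∫ x, kernelOp A u x = -pathNorm A 1 := by
    have := integral_mul_kernelOp hA hanti (isBddMeas_const 1) hub
    simpa [hq] using this
  have e1 : ∫ p : I × I, A p.1 p.2 * u p.1 = pathNorm A 1 := by
    rw [h1.integral_eq, hq]
    simp only [integral_mul_const, hux]
  have e2 : ∫ p : I × I, A p.2 p.1 * u p.2 = pathNorm A 1 := by
    rw [h2.integral_eq]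
    have : ∀ x, ∫ y, A y x * u y = -kernelOp A u x := fun x => by
      rw [kernelOp, ← integral_neg]
      congr 1 with y
      rw [hanti y x]; ring
    simp only [this, integral_neg, huu, neg_neg]
  have e3 : ∫ p : I × I, kernelOp A (A p.2) p.1 = pathNorm A 1 := by
    rw [h3.integral_eq_symm]
    have : ∀ y, ∫ x, kernelOp A (A y) x = -kernelOp A u y := fun y => by
      have := integral_mul_kernelOp hA hanti (isBddMeas_const 1) (hA.section y)
      simp only [one_mul, ← hu] at this
      rw [this, kernelOp]
      simp only [mul_comm]
    simp only [this, integral_neg, huu, neg_neg]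
  have hle : ∫ p : I × I, (A p.1 p.2 * u p.1 + A p.2 p.1 * u p.2 + kernelOp A (A p.2) p.1) ≤
      ∫ _ : I × I, (1 : ℝ) := by
    refine integral_mono ((h1.integrable.add h2.integrable).add h3.integrable)
      (integrable_const _) fun p => ?_
    have i1 := (hA.section p.1).integrable
    have i2 := (hA.section p.2).integrable
    have i3 := ((hA.section p.1).mul (hA.section p.2)).integrable
    have : A p.1 p.2 * u p.1 + A p.2 p.1 * u p.2 + kernelOp A (A p.2) p.1 =
        ∫ z, (A p.1 p.2 * A p.1 z + A p.2 p.1 * A p.2 z + A p.1 z * A p.2 z) := by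
      rw [integral_add_add (i1.const_mul _) (i2.const_mul _) i3, integral_const_mul, integral_const_mul,
        hux, hux, kernelOp]
    simp only [this]
    calc _ ≤ ∫ _ : I, (1 : ℝ) := by
          refine integral_mono (((i1.const_mul _).add (i2.const_mul _)).add i3)
            (integrable_const _) fun z => ?_
          have := neg_mul_add_mul_add_mul_le_one (hA1 p.1 p.2) (hA1 p.2 z) (hA1 z p.1)
          simp only [hanti p.2 p.1, hanti z p.1] at this ⊢
          linarith
      _ = 1 := by simp
  have hs : ∫ p : I × I, (A p.1 p.2 * u p.1 + A p.2 p.1 * u p.2 + kernelOp A (A p.2) p.1) =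
      pathNorm A 1 + pathNorm A 1 + pathNorm A 1 := by
    rw [integral_add_add h1.integrable h2.integrable h3.integrable, e1, e2, e3]
  rw [hs] at hle
  simp at hle
  linarith

/-! ### Vanishing of the cycle density forces `A = 0` -/

/-- The density of the directed cycle of even length with half of its edges reversed. -/
noncomputable def cycleNorm (A : I → I → ℝ) (k : ℕ) : ℝ :=
  ∫ a, ∫ x, (kernelOp A)^[k] (A a) x ^ 2

theorem integral_sq_eq_zero {f : I → ℝ} (hf : IsBddMeas f) (h : ∫ x, f x ^ 2 = 0) :
    ∀ᵐ x, f x = 0 := by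
  have hi : Integrable fun x => f x ^ 2 := by simpa only [sq] using (hf.mul hf).integrable
  have := (integral_eq_zero_iff_of_nonneg (fun x => sq_nonneg _) hi).mp h
  filter_upwards [this] with x hx
  simpa using hx

/-- A skew-adjoint `T` satisfies `‖T^(k+1) f‖² = -⟨T^k f, T^(k+2) f⟩`, so vanishing of a higher
iterate descends one step at a time. -/
theorem integral_iterate_sq_eq_zero {A : I → I → ℝ} (hA : IsKernel A)
    (hanti : ∀ x y, A x y = -A y x) {f : I → ℝ} (hf : IsBddMeas f) (k : ℕ)
    (h : ∫ x, (kernelOp A)^[k + 1] f x ^ 2 = 0) : ∫ x, kernelOp A f x ^ 2 = 0 := by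
  induction k with
  | zero => exact h
  | succ k ih =>
    apply ih
    have h0 := integral_sq_eq_zero (hf.kernelOp_iterate hA _) h
    have h1 := integral_mul_kernelOp hA hanti (hf.kernelOp_iterate hA k)
      (hf.kernelOp_iterate hA (k + 1))
    simp only [← Function.iterate_succ_apply' (kernelOp A)] at h1
    have h2 : ∫ x, (kernelOp A)^[k] f x * (kernelOp A)^[k + 1 + 1] f x = 0 := by
      rw [← integral_zero I ℝ]
      refine integral_congr_ae ?_
      filter_upwards [h0] with x hx
      rw [hx, mul_zero]
    simp only [sq]
    linarith

/-- A kernel that integrates to zero over all measurable rectangles vanishes almost everywhere. -/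
theorem ae_eq_zero_of_kernelOp {A : I → I → ℝ} (hA : IsKernel A)
    (h : ∀ g : I → ℝ, IsBddMeas g → ∀ᵐ x, kernelOp A g x = 0) :
    ∀ᵐ p : I × I, A p.1 p.2 = 0 := by
  have hi := hA.integrable
  have hrect : ∀ s t : Set I, MeasurableSet s → MeasurableSet t →
      ∫ p in s ×ˢ t, A p.1 p.2 = 0 := by
    intro s t hs ht
    rw [Measure.volume_eq_prod, setIntegral_prod (fun p : I × I => A p.1 p.2) hi.integrableOn,
      ← integral_zero I ℝ, ← integral_indicator hs]
    refine integral_congr_ae ?_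
    have hg : IsBddMeas (t.indicator fun _ => 1) :=
      ⟨measurable_const.indicator ht, 1, fun x => by
        by_cases hx : x ∈ t <;> simp [hx]⟩
    filter_upwards [h _ hg] with x hx
    by_cases hxs : x ∈ s
    · rw [Set.indicator_of_mem hxs, ← hx, kernelOp, ← integral_indicator ht]
      congr 1 with y
      by_cases hy : y ∈ t <;> simp [hy]
    · rw [Set.indicator_of_notMem hxs]
  have hall : ∀ S : Set (I × I), MeasurableSet S → ∫ p in S, A p.1 p.2 = 0 := by
    intro S hS
    -- Rectangles form a π-system generating the product σ-algebra, so the vanishing of the integral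
    -- extends to all measurable sets.
    refine MeasurableSpace.induction_on_inter (C := fun S _ => ∫ p in S, A p.1 p.2 = 0)
      generateFrom_prod.symm isPiSystem_prod ?_ ?_ ?_ ?_ S hS
    · simp
    · rintro _ ⟨s, hs, t, ht, rfl⟩
      exact hrect s t hs ht
    · intro t ht h0
      have h1 := integral_add_compl ht hi
      have h2 := hrect Set.univ Set.univ MeasurableSet.univ MeasurableSet.univ
      rw [Set.univ_prod_univ, setIntegral_univ] at h2
      change (∫ p in t, A p.1 p.2) + ∫ p in tᶜ, A p.1 p.2 = ∫ p : I × I, A p.1 p.2 at h1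
      rw [h0, h2, zero_add] at h1
      exact h1
    · intro f hd hf h0
      rw [integral_iUnion hf hd hi.integrableOn]
      simp [h0]
  exact hi.ae_eq_zero_of_forall_setIntegral_eq_zero fun s hs _ => hall s hs

/-- Vanishing of the iterates gives `T (A a) = 0` for almost every `a`. Since `T (T g) a = ⟨A a, T
g⟩ = -⟨T (A a), g⟩`, this gives `T² g = 0`, hence `T g = 0`, for every bounded measurable `g`. -/
theorem ae_eq_zero_of_cycleNorm {A : I → I → ℝ} (hA : IsKernel A)
    (hanti : ∀ x y, A x y = -A y x) (k : ℕ) (h : cycleNorm A (k + 1) = 0) :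
    ∀ᵐ p : I × I, A p.1 p.2 = 0 := by
  have hK := hA.kernelOp_iterate hA (k + 1)
  have hsq : IsKernel fun a x => (kernelOp A)^[k + 1] (A a) x ^ 2 := by
    simpa only [sq] using hK.mul hK
  have h1 : ∀ᵐ a, ∫ x, (kernelOp A)^[k + 1] (A a) x ^ 2 = 0 :=
    (integral_eq_zero_iff_of_nonneg (fun a => integral_nonneg fun x => sq_nonneg _)
      hsq.integral.integrable).mp h
  have h2 : ∀ᵐ a, ∀ᵐ x, kernelOp A (A a) x = 0 := by
    filter_upwards [h1] with a ha
    exact integral_sq_eq_zero ((hA.section a).kernelOp hA)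
      (integral_iterate_sq_eq_zero hA hanti (hA.section a) k ha)
  refine ae_eq_zero_of_kernelOp hA fun g hg => ?_
  have h3 : ∀ᵐ a, kernelOp A (kernelOp A g) a = 0 := by
    filter_upwards [h2] with a ha
    have e := integral_mul_kernelOp hA hanti (hA.section a) hg
    have : ∫ x, kernelOp A (A a) x * g x = 0 := by
      rw [← integral_zero I ℝ]
      refine integral_congr_ae ?_
      filter_upwards [ha] with x hx
      rw [hx, zero_mul]
    rw [this, neg_zero] at e
    exact e
  refine integral_sq_eq_zero (hg.kernelOp hA) (integral_iterate_sq_eq_zero hA hanti hg 1 ?_)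
  rw [← integral_zero I ℝ]
  refine integral_congr_ae ?_
  filter_upwards [h3] with x hx
  simpa using hx

/-! ### Densities under copies, reversals and disjoint unions -/

theorem mem_edges {V : Type*} [Fintype V] (G : OrientedGraph V) (e : V × V) :
    e ∈ G.edges ↔ G.Adj e.1 e.2 := by
  simp [edges]

theorem IsKernel.measurable_prod {A : I → I → ℝ} (hA : IsKernel A) {V : Type*}
    (F : Finset (V × V)) : Measurable fun x : V → I => ∏ e ∈ F, A (x e.1) (x e.2) :=
  Finset.measurable_prod _ fun e _ => hA.measurable_eval e.1 e.2

theorem IsKernel.integrable_prod {A : I → I → ℝ} (hA : IsKernel A) {V : Type*} [Fintype V]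
    (F : Finset (V × V)) : Integrable fun x : V → I => ∏ e ∈ F, A (x e.1) (x e.2) := by
  have h := hA.measurable_prod F
  obtain ⟨-, M, hM⟩ := hA
  refine integrable_of_abs_le h (M := ∏ _e ∈ F, M) fun x => ?_
  rw [Finset.abs_prod]
  exact Finset.prod_le_prod (fun _ _ => abs_nonneg _) fun i _ => hM _ _

theorem prod_edges {V ι M : Type*} [Fintype V] [Fintype ι] [CommMonoid M] (G : OrientedGraph V)
    (φ : ι → V × V) (hinj : Function.Injective φ)
    (hφ : ∀ e : V × V, G.Adj e.1 e.2 ↔ ∃ i, φ i = e) (g : V × V → M) :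
    ∏ e ∈ G.edges, g e = ∏ i, g (φ i) := by
  classical
  have : G.edges = Finset.univ.image φ := by
    ext e
    simp [mem_edges, hφ]
  rw [this, Finset.prod_image fun _ _ _ _ h => hinj h]

/-- This is why isolated vertices do not affect densities: forgetting coordinates of a product of
probability spaces preserves the measure. -/
theorem measurePreserving_comp_embedding {V W : Type*} [Fintype V] [Fintype W] (f : V ↪ W) :
    MeasurePreserving (fun (x : W → I) (v : V) => x (f v)) := by
  classical
  have hm : Measurable fun (x : W → I) (v : V) => x (f v) := by fun_prop
  refine ⟨hm, (Measure.pi_eq fun s hs => ?_).symm⟩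
  rw [Measure.map_apply hm (MeasurableSet.univ_pi hs)]
  have : (fun (x : W → I) (v : V) => x (f v)) ⁻¹' Set.univ.pi s =
      Set.univ.pi (Function.extend f s fun _ => Set.univ) := by
    ext x
    simp only [Set.mem_preimage, Set.mem_univ_pi]
    refine ⟨fun h w => ?_, fun h v => ?_⟩
    · by_cases hw : ∃ v, f v = w
      · obtain ⟨v, rfl⟩ := hw
        rw [f.injective.extend_apply]
        exact h v
      · rw [Function.extend_apply' _ _ _ hw]
        trivial
    · have := h (f v)
      rwa [f.injective.extend_apply] at this
  rw [this, volume_pi_pi]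
  rw [← Finset.prod_subset (Finset.subset_univ (Finset.univ.map f)), Finset.prod_map]
  · simp only [f.injective.extend_apply]
  · intro w _ hw
    rw [Function.extend_apply' _ _ _ (by simpa using hw), measure_univ]

theorem IsCopyWithIsolated.homDensity_eq {V W : Type*} [Fintype V] [Fintype W]
    {H : OrientedGraph W} {G : OrientedGraph V} (h : H.IsCopyWithIsolated G) {A : I → I → ℝ}
    (hA : IsKernel A) : H.homDensity A = G.homDensity A := by
  obtain ⟨f, hf⟩ := h
  have he : H.edges = G.edges.map (f.prodMap f) := by
    ext ⟨a, b⟩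
    simp only [mem_edges, hf, Finset.mem_map, Prod.exists]
    refine ⟨?_, ?_⟩
    · rintro ⟨u, v, rfl, rfl, h⟩
      exact ⟨u, v, h, rfl⟩
    · rintro ⟨u, v, h, he⟩
      obtain ⟨rfl, rfl⟩ := Prod.mk.inj he
      exact ⟨u, v, rfl, rfl, h⟩
  have hp := measurePreserving_comp_embedding f
  rw [homDensity, homDensity, ← hp.map_eq, integral_map hp.measurable.aemeasurable
    (hA.measurable_prod _).aestronglyMeasurable, he]
  simp [Finset.prod_map]

theorem homDensity_reverse {V : Type*} [Fintype V] (G : OrientedGraph V) {R : Finset (V × V)}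
    (hR : R ⊆ G.edges) {A : I → I → ℝ} (hanti : ∀ x y, A x y = -A y x) :
    (G.reverse R).homDensity A = (-1) ^ R.card * G.homDensity A := by
  classical
  have he : (G.reverse R).edges = (G.edges \ R) ∪ R.map (Equiv.prodComm V V).toEmbedding := by
    ext ⟨a, b⟩
    simp only [mem_edges, reverse, Finset.mem_union, Finset.mem_sdiff, Finset.mem_map_equiv,
      Equiv.prodComm_symm, Equiv.prodComm_apply, Prod.swap_prod_mk]
    have := @hR (b, a)
    rw [mem_edges] at this
    tauto
  have hd : Disjoint (G.edges \ R) (R.map (Equiv.prodComm V V).toEmbedding) := by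
    rw [Finset.disjoint_left]
    rintro ⟨a, b⟩ h1 h2
    rw [Finset.mem_map_equiv] at h2
    rw [Finset.mem_sdiff, mem_edges] at h1
    have := hR h2
    rw [mem_edges] at this
    exact G.asymm _ _ h1.1 this
  rw [homDensity, homDensity, ← integral_const_mul]
  congr 1 with x
  rw [he, Finset.prod_union hd, ← Finset.prod_sdiff hR, Finset.prod_map]
  have : ∏ e ∈ R, A (x ((Equiv.prodComm V V).toEmbedding e).1)
      (x ((Equiv.prodComm V V).toEmbedding e).2) = (-1) ^ R.card * ∏ e ∈ R, A (x e.1) (x e.2) := by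
    rw [← Finset.prod_const, ← Finset.prod_mul_distrib]
    refine Finset.prod_congr rfl fun e _ => ?_
    rw [neg_one_mul]
    exact hanti _ _
  rw [this]
  ring

theorem EvenReversal.homDensity_eq {V W : Type*} [Fintype V] [Fintype W] {H : OrientedGraph W}
    {G : OrientedGraph V} (h : H.EvenReversal G) {A : I → I → ℝ} (hA : IsKernel A)
    (hanti : ∀ x y, A x y = -A y x) : H.homDensity A = G.homDensity A := by
  obtain ⟨R, hR, hp, hc⟩ := h
  rw [hc.homDensity_eq hA, homDensity_reverse G hR hanti, hp.neg_one_pow, one_mul]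

theorem OddReversal.homDensity_eq {V W : Type*} [Fintype V] [Fintype W] {H : OrientedGraph W}
    {G : OrientedGraph V} (h : H.OddReversal G) {A : I → I → ℝ} (hA : IsKernel A)
    (hanti : ∀ x y, A x y = -A y x) : H.homDensity A = -G.homDensity A := by
  obtain ⟨R, hR, hp, hc⟩ := h
  rw [hc.homDensity_eq hA, homDensity_reverse G hR hanti, hp.neg_one_pow, neg_one_mul]

theorem evenReversal_or_oddReversal {V W : Type*} [Fintype V] {H : OrientedGraph W}
    {G : OrientedGraph V} (f : V ↪ W)
    (h : ∀ a b, (H.Adj a b ∨ H.Adj b a) ↔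
      ∃ u v, f u = a ∧ f v = b ∧ (G.Adj u v ∨ G.Adj v u)) :
    H.EvenReversal G ∨ H.OddReversal G := by
  classical
  -- The edges to reverse are those whose image under `f` is directed the other way in `H`.
  have key : H.IsCopyWithIsolated
      (G.reverse (G.edges.filter fun e => ¬H.Adj (f e.1) (f e.2))) := by
    refine ⟨f, fun a b => ⟨fun hab => ?_, ?_⟩⟩
    · obtain ⟨u, v, rfl, rfl, huv⟩ := (h a b).mp (Or.inl hab)
      refine ⟨u, v, rfl, rfl, ?_⟩
      simp only [reverse, Finset.mem_filter, mem_edges]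
      have := H.asymm _ _ hab
      tauto
    · rintro ⟨u, v, rfl, rfl, huv⟩
      simp only [reverse, Finset.mem_filter, mem_edges] at huv
      have := (h (f u) (f v)).mpr ⟨u, v, rfl, rfl, by tauto⟩
      tauto
  rcases Nat.even_or_odd (G.edges.filter fun e => ¬H.Adj (f e.1) (f e.2)).card with hp | hp
  · exact Or.inl ⟨_, Finset.filter_subset _ _, hp, key⟩
  · exact Or.inr ⟨_, Finset.filter_subset _ _, hp, key⟩

theorem homDensity_disjUnion {ι : Type*} [Fintype ι] {V : ι → Type*} [∀ i, Fintype (V i)]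
    (G : ∀ i, OrientedGraph (V i)) (A : I → I → ℝ) :
    (disjUnion G).homDensity A = ∏ i, (G i).homDensity A := by
  classical
  have he : ∀ g : (Σ i, V i) × (Σ i, V i) → ℝ, ∏ e ∈ (disjUnion G).edges, g e =
      ∏ i, ∏ e ∈ (G i).edges, g (⟨i, e.1⟩, ⟨i, e.2⟩) := by
    intro g
    rw [Finset.prod_sigma']
    symm
    refine Finset.prod_bij (fun p _ => (⟨p.1, p.2.1⟩, ⟨p.1, p.2.2⟩)) ?_ ?_ ?_ ?_
    · rintro ⟨i, u, v⟩ h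
      rw [Finset.mem_sigma, mem_edges] at h
      rw [mem_edges]
      exact ⟨i, u, v, rfl, rfl, h.2⟩
    · rintro ⟨i, u, v⟩ _ ⟨j, u', v'⟩ _ h
      simp only [Prod.mk.injEq, Sigma.mk.injEq] at h
      obtain ⟨⟨rfl, h1⟩, -, h2⟩ := h
      rw [eq_of_heq h1, eq_of_heq h2]
    · rintro ⟨a, b⟩ h
      rw [mem_edges] at h
      obtain ⟨i, u, v, rfl, rfl, h⟩ := h
      exact ⟨⟨i, u, v⟩, by rw [Finset.mem_sigma, mem_edges]; exact ⟨Finset.mem_univ _, h⟩, rfl⟩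
    · intros
      rfl
  -- Currying the coordinates by component makes the integrand a product of functions of independent
  -- variables.
  have hmp : MeasurePreserving (MeasurableEquiv.piCurry fun (i : ι) (_ : V i) => I) := by
    refine ⟨MeasurableEquiv.measurable _, ?_⟩
    have := Measure.infinitePi_map_piCurry (X := fun (i : ι) (_ : V i) => I)
      fun _ _ => (volume : Measure I)
    simp only [Measure.infinitePi_eq_pi] at this
    exact this
  have h := hmp.integral_comp' fun y : ∀ i, V i → I =>
    ∏ i, ∏ e ∈ (G i).edges, A (y i e.1) (y i e.2)
  rw [integral_fintype_prod_volume_eq_prod (E := fun i => V i → I) fun i y =>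
    ∏ e ∈ (G i).edges, A (y e.1) (y e.2)] at h
  rw [homDensity, ← show _ = ∏ i, (G i).homDensity A from h]
  congr 1 with x
  rw [he]
  rfl

/-! ### Densities of paths and of the cycle `D_ℓ` -/

/-- The directed path with `r` edges. -/
def directedPath (r : ℕ) : OrientedGraph (Fin (r + 1)) where
  Adj i j := j.val = i.val + 1
  asymm i j := by omega

theorem homDensity_directedPath {A : I → I → ℝ} (hA : IsKernel A) (r : ℕ) :
    (directedPath r).homDensity A = ∫ x, (kernelOp A)^[r] (fun _ => 1) x := by
  rw [← integral_path hA r (isBddMeas_const 1).kernel_fst, homDensity]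
  congr 1 with x
  rw [mul_one]
  refine prod_edges _ (fun i : Fin r => (i.castSucc, i.succ)) (fun i j h => ?_) (fun e => ?_) _
  · exact Fin.castSucc_injective _ (Prod.mk.inj h).1
  · obtain ⟨a, b⟩ := e
    simp only [directedPath, Prod.mk.injEq, Fin.ext_iff, Fin.val_castSucc, Fin.val_succ]
    refine ⟨fun h => ⟨⟨a, by omega⟩, rfl, h.symm⟩, ?_⟩
    rintro ⟨i, h1, h2⟩
    omega

/-- Skew-adjointness gives `⟨1, T^r 1⟩ = (-1)^r ⟨T^r 1, 1⟩`, so for odd `r` the density is its own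
negative. -/
theorem homDensity_directedPath_of_odd {A : I → I → ℝ} (hA : IsKernel A)
    (hanti : ∀ x y, A x y = -A y x) {r : ℕ} (hr : Odd r) :
    (directedPath r).homDensity A = 0 := by
  have h := integral_mul_kernelOp_iterate hA hanti (isBddMeas_const 1) (isBddMeas_const 1) r
  rw [hr.neg_one_pow] at h
  simp only [one_mul, mul_one] at h
  rw [homDensity_directedPath hA]
  linarith

theorem prod_ite_lt {M : Type*} [CommMonoid M] (a b : M) (c d : ℕ) :
    ∏ i : Fin (c + d), (if i.val < c then a else b) = a ^ c * b ^ d := by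
  rw [Fin.prod_univ_eq_prod_range (fun i => if i < c then a else b), Finset.prod_range_add]
  congr 1
  · rw [Finset.prod_congr rfl fun i hi => if_pos (Finset.mem_range.mp hi)]
    simp
  · simp

/-- `Q_{2n}` is the directed path with its first `n` edges reversed. The resulting sign `(-1)^n`
cancels the sign from moving `n` copies of `T` across the inner product. -/
theorem homDensity_pathQ {A : I → I → ℝ} (hA : IsKernel A)
    (hanti : ∀ x y, A x y = -A y x) (n : ℕ) : (pathQ n).homDensity A = pathNorm A n := by
  have h1 : (pathQ n).homDensity A = (-1) ^ n * (directedPath (2 * n)).homDensity A := by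
    rw [homDensity_directedPath hA, ← integral_path hA (2 * n) (isBddMeas_const 1).kernel_fst,
      homDensity, ← integral_const_mul]
    congr 1 with x
    rw [mul_one, prod_edges _ (fun i : Fin (2 * n) =>
      if i.val < n then (i.succ, i.castSucc) else (i.castSucc, i.succ)) (fun i j h => ?_)
      (fun e => ?_)]
    · have : (-1 : ℝ) ^ n = ∏ i : Fin (2 * n), if i.val < n then -1 else 1 := by
        rw [Fin.prod_univ_eq_prod_range (fun i => if i < n then (-1 : ℝ) else 1), two_mul,
          ← Fin.prod_univ_eq_prod_range (fun i => if i < n then (-1 : ℝ) else 1), prod_ite_lt,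
          one_pow, mul_one]
      rw [this, ← Finset.prod_mul_distrib]
      refine Finset.prod_congr rfl fun i _ => ?_
      split_ifs
      · rw [neg_one_mul]
        exact hanti _ _
      · rw [one_mul]
    · simp only at h
      split_ifs at h <;> simp only [Prod.mk.injEq, Fin.ext_iff, Fin.val_castSucc,
        Fin.val_succ] at h ⊢ <;> omega
    · obtain ⟨a, b⟩ := e
      simp only [pathQ]
      constructor
      · rintro (⟨h, h'⟩ | ⟨h, h'⟩)
        · refine ⟨⟨a, by omega⟩, ?_⟩
          rw [if_neg (by simpa using h)]
          simp [Fin.ext_iff, h']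
        · refine ⟨⟨b, by omega⟩, ?_⟩
          rw [if_pos (by simp; omega)]
          simp [Fin.ext_iff, h']
      · rintro ⟨i, hi⟩
        split_ifs at hi <;> simp only [Prod.mk.injEq, Fin.ext_iff, Fin.val_castSucc,
          Fin.val_succ] at hi ⊢ <;> omega
  have h2 := integral_mul_kernelOp_iterate hA hanti (isBddMeas_const 1)
    ((isBddMeas_const 1).kernelOp_iterate hA n) n
  simp only [one_mul, ← Function.iterate_add_apply] at h2
  rw [h1, homDensity_directedPath hA, two_mul, h2, ← mul_assoc, ← mul_pow, pathNorm]
  simp [sq]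

theorem homDensity_cycleD {A : I → I → ℝ} (hA : IsKernel A)
    (hanti : ∀ x y, A x y = -A y x) (j : ℕ) (hj : 1 ≤ j) :
    (cycleD (j + 1)).homDensity A = cycleNorm A j := by
  have key : ∀ G : OrientedGraph (Fin (2 * j + 1 + 1)),
      (∀ a b, G.Adj a b ↔ (a.val < j + 1 ∧ b.val = a.val + 1) ∨
        (j + 1 ≤ b.val ∧ a.val = b.val + 1) ∨ (a.val = 0 ∧ b.val + 1 = 2 * (j + 1))) →
      G.homDensity A = (-1) ^ j * ∫ a, (kernelOp A)^[2 * j + 1] (A a) a := by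
    intro G hG
    rw [← integral_path hA (2 * j + 1) hA, homDensity, ← integral_const_mul]
    congr 1 with x
    -- `none` is the closing edge from `0` to the last vertex, which supplies `H = A` in
    -- `integral_path`. Of the remaining `2 * j + 1` edges, the first `j + 1` go forward and the
    -- last `j` backward, whence the sign `(-1) ^ j`.
    rw [prod_edges (ι := Option (Fin (2 * j + 1))) _ (fun o => o.elim
      ((0 : Fin (2 * j + 1 + 1)), Fin.last (2 * j + 1)) fun i : Fin (2 * j + 1) =>
      if i.val < j + 1 then (i.castSucc, i.succ) else (i.succ, i.castSucc)) (fun o o' h => ?_) (fun e => ?_)]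
    · have : (-1 : ℝ) ^ j = ∏ i : Fin (2 * j + 1), if i.val < j + 1 then 1 else -1 := by
        rw [Fin.prod_univ_eq_prod_range (fun i => if i < j + 1 then (1 : ℝ) else -1),
          show 2 * j + 1 = (j + 1) + j by ring,
          ← Fin.prod_univ_eq_prod_range (fun i => if i < j + 1 then (1 : ℝ) else -1), prod_ite_lt,
          one_pow, one_mul]
      rw [this, Fintype.prod_option, ← mul_assoc, ← Finset.prod_mul_distrib, mul_comm]
      congr 1
      refine Finset.prod_congr rfl fun i _ => ?_
      simp only [Option.elim_some]
      split_ifs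
      · rw [one_mul]
      · rw [neg_one_mul]
        exact hanti _ _
    · rcases o with _ | i <;> rcases o' with _ | i'
      · rfl
      · simp only [Option.elim_none, Option.elim_some] at h
        split_ifs at h <;> simp only [Prod.mk.injEq, Fin.ext_iff, Fin.val_castSucc,
          Fin.val_succ, Fin.val_zero, Fin.val_last] at h <;> omega
      · simp only [Option.elim_none, Option.elim_some] at h
        split_ifs at h <;> simp only [Prod.mk.injEq, Fin.ext_iff, Fin.val_castSucc,
          Fin.val_succ, Fin.val_zero, Fin.val_last] at h <;> omega
      · simp only [Option.elim_some] at h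
        rw [Option.some_inj]
        split_ifs at h <;> simp only [Prod.mk.injEq, Fin.ext_iff, Fin.val_castSucc,
          Fin.val_succ] at h ⊢ <;> omega
    · obtain ⟨a, b⟩ := e
      simp only [hG]
      constructor
      · rintro (⟨h, h'⟩ | ⟨h, h'⟩ | ⟨h, h'⟩)
        · refine ⟨some ⟨a, by omega⟩, ?_⟩
          rw [Option.elim_some, if_pos (by simpa using h)]
          simp [Fin.ext_iff, h']
        · refine ⟨some ⟨b, by omega⟩, ?_⟩
          rw [Option.elim_some, if_neg (by simp; omega)]
          simp [Fin.ext_iff, h']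
        · refine ⟨none, ?_⟩
          simp only [Option.elim_none, Prod.mk.injEq, Fin.ext_iff, Fin.val_zero, Fin.val_last]
          omega
      · rintro ⟨_ | i, hi⟩
        · simp only [Option.elim_none, Prod.mk.injEq, Fin.ext_iff, Fin.val_zero,
            Fin.val_last] at hi
          omega
        · simp only [Option.elim_some] at hi
          split_ifs at hi <;> simp only [Prod.mk.injEq, Fin.ext_iff, Fin.val_castSucc,
            Fin.val_succ] at hi ⊢ <;> omega
  rw [key (cycleD (j + 1)) fun a b => Iff.rfl, cycleNorm, ← integral_const_mul]
  congr 1 with a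
  have h2 := integral_mul_kernelOp_iterate hA hanti (hA.section a)
    ((hA.section a).kernelOp_iterate hA j) j
  simp only [← Function.iterate_add_apply] at h2
  rw [Function.iterate_succ_apply', kernelOp, two_mul, h2, ← mul_assoc, ← mul_pow]
  simp [sq]

/-! ### Linear forests and the uniqueness of their path lengths -/

/-- Adjacency in the disjoint union of undirected paths with `r j` edges. -/
def PathAdj {J : Type*} {r : J → ℕ} (p q : Σ j, Fin (r j + 1)) : Prop :=
  p.1 = q.1 ∧ (q.2.val = p.2.val + 1 ∨ p.2.val = q.2.val + 1)

/-- The underlying graph of `H` consists of disjoint paths with `r j` edges, embedded by `f`,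
and isolated vertices. -/
def IsPathUnion {V J : Type*} (H : OrientedGraph V) (r : J → ℕ) (f : (Σ j, Fin (r j + 1)) ↪ V) :
    Prop :=
  ∀ a b, (H.Adj a b ∨ H.Adj b a) ↔ ∃ p q, f p = a ∧ f q = b ∧ PathAdj p q

theorem disjUnion_pathQ_adj {J : Type*} (n : J → ℕ) (p q : Σ j, Fin (2 * n j + 1)) :
    ((disjUnion fun j => pathQ (n j)).Adj p q ∨ (disjUnion fun j => pathQ (n j)).Adj q p) ↔
      PathAdj (r := fun j => 2 * n j) p q := by
  constructor
  · rintro (⟨i, u, v, rfl, rfl, h⟩ | ⟨i, u, v, rfl, rfl, h⟩) <;>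
      refine ⟨rfl, ?_⟩ <;> simp only [pathQ] at h ⊢ <;> omega
  · obtain ⟨i, u⟩ := p
    obtain ⟨j, v⟩ := q
    rintro ⟨h, h'⟩
    obtain rfl : i = j := h
    have : (pathQ (n i)).Adj u v ∨ (pathQ (n i)).Adj v u := by
      simp only [pathQ]
      simp only at h'
      omega
    exact this.imp (fun h => ⟨i, u, v, rfl, rfl, h⟩) fun h => ⟨i, v, u, rfl, rfl, h⟩

theorem disjUnion_directedPath_adj {J : Type*} (r : J → ℕ) (p q : Σ j, Fin (r j + 1)) :
    ((disjUnion fun j => directedPath (r j)).Adj p q ∨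
      (disjUnion fun j => directedPath (r j)).Adj q p) ↔ PathAdj p q := by
  constructor
  · rintro (⟨i, u, v, rfl, rfl, h⟩ | ⟨i, u, v, rfl, rfl, h⟩) <;>
      refine ⟨rfl, ?_⟩ <;> simp only [directedPath] at h ⊢ <;> omega
  · obtain ⟨i, u⟩ := p
    obtain ⟨j, v⟩ := q
    rintro ⟨h, h'⟩
    obtain rfl : i = j := h
    exact h'.imp (fun h => ⟨i, u, v, rfl, rfl, h⟩) fun h => ⟨i, v, u, rfl, rfl, h⟩

theorem IsPathUnion.of_reversal {V J : Type*} [Fintype J] {H : OrientedGraph V} {n : J → ℕ}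
    (h : H.EvenReversal (disjUnion fun j => pathQ (n j)) ∨
      H.OddReversal (disjUnion fun j => pathQ (n j))) :
    ∃ f, H.IsPathUnion (fun j => 2 * n j) f := by
  obtain ⟨R, hR, f, hf⟩ : ∃ R ⊆ (disjUnion fun j => pathQ (n j)).edges,
      H.IsCopyWithIsolated ((disjUnion fun j => pathQ (n j)).reverse R) := by
    rcases h with ⟨R, hR, -, h⟩ | ⟨R, hR, -, h⟩
    · exact ⟨R, hR, h⟩
    · exact ⟨R, hR, h⟩
  refine ⟨f, fun a b => ?_⟩
  simp only [← disjUnion_pathQ_adj, hf, reverse]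
  constructor
  · rintro (⟨u, v, rfl, rfl, h⟩ | ⟨u, v, rfl, rfl, h⟩)
    · exact ⟨u, v, rfl, rfl, by tauto⟩
    · exact ⟨v, u, rfl, rfl, by tauto⟩
  · rintro ⟨u, v, rfl, rfl, h⟩
    by_cases h1 : (u, v) ∈ R
    · have h1' := hR h1
      rw [mem_edges] at h1'
      exact Or.inr ⟨v, u, rfl, rfl, Or.inr ⟨h1', h1⟩⟩
    · by_cases h2 : (v, u) ∈ R
      · have h2' := hR h2
        rw [mem_edges] at h2'
        exact Or.inl ⟨u, v, rfl, rfl, Or.inr ⟨h2', h2⟩⟩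
      · rcases h with h | h
        · exact Or.inl ⟨u, v, rfl, rfl, Or.inl ⟨h, h1⟩⟩
        · exact Or.inr ⟨v, u, rfl, rfl, Or.inl ⟨h, h2⟩⟩

/-- The vertices that are joined to `a` by a path. -/
def component {V : Type*} (H : OrientedGraph V) (a : V) : Set V :=
  {b | Relation.ReflTransGen (fun a b => H.Adj a b ∨ H.Adj b a) a b}

theorem IsPathUnion.component_eq {V J : Type*} {H : OrientedGraph V} {r : J → ℕ}
    {f : (Σ j, Fin (r j + 1)) ↪ V} (hf : H.IsPathUnion r f) (p : Σ j, Fin (r j + 1)) :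
    H.component (f p) = f '' {q | q.1 = p.1} := by
  apply Set.Subset.antisymm
  · intro b hb
    induction hb with
    | refl => exact ⟨p, rfl, rfl⟩
    | tail _ hbc ih =>
      obtain ⟨q, hq, rfl⟩ := ih
      obtain ⟨s, t, hs, rfl, hst⟩ := (hf _ _).mp hbc
      obtain rfl := f.injective hs
      exact ⟨t, hst.1.symm.trans hq, rfl⟩
  · have hsymm : Std.Symm fun a b => H.Adj a b ∨ H.Adj b a := ⟨fun a b h => h.symm⟩
    have h0 : ∀ (i : J) (k : ℕ) (hk : k < r i + 1),
        Relation.ReflTransGen (fun a b => H.Adj a b ∨ H.Adj b a) (f ⟨i, 0⟩) (f ⟨i, ⟨k, hk⟩⟩) := by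
      intro i k
      induction k with
      | zero => exact fun _ => Relation.ReflTransGen.refl
      | succ k ih =>
        intro hk
        exact (ih (by omega)).tail ((hf _ _).mpr ⟨⟨i, ⟨k, by omega⟩⟩, ⟨i, ⟨k + 1, hk⟩⟩, rfl, rfl,
          rfl, Or.inl rfl⟩)
    rintro _ ⟨⟨i, u⟩, hi, rfl⟩
    obtain ⟨j, v⟩ := p
    obtain rfl : i = j := hi
    exact (Relation.ReflTransGen.stdSymm.symm _ _ (h0 i v.1 v.2)).trans (h0 i u.1 u.2)

theorem IsPathUnion.ncard_component {V J : Type*} {H : OrientedGraph V} {r : J → ℕ}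
    {f : (Σ j, Fin (r j + 1)) ↪ V} (hf : H.IsPathUnion r f) (p : Σ j, Fin (r j + 1)) :
    (H.component (f p)).ncard = r p.1 + 1 := by
  have : {q : Σ j, Fin (r j + 1) | q.1 = p.1} = Sigma.mk p.1 '' Set.univ := by
    ext ⟨i, u⟩
    constructor
    · intro h
      obtain rfl : i = p.1 := h
      exact ⟨u, trivial, rfl⟩
    · rintro ⟨u, -, h⟩
      exact (congrArg Sigma.fst h).symm
  rw [hf.component_eq, Set.ncard_image_of_injective _ f.injective, this,
    Set.ncard_image_of_injective _ sigma_mk_injective, Set.ncard_univ, Nat.card_fin]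

theorem IsPathUnion.component_of_notMem {V J : Type*} {H : OrientedGraph V} {r : J → ℕ}
    {f : (Σ j, Fin (r j + 1)) ↪ V} (hf : H.IsPathUnion r f) {a : V} (ha : a ∉ Set.range f) :
    H.component a = {a} := by
  apply Set.Subset.antisymm
  · intro b hb
    induction hb with
    | refl => rfl
    | tail _ hbc ih =>
      obtain rfl := ih
      obtain ⟨p, q, hp, -⟩ := (hf _ _).mp hbc
      exact (ha ⟨p, hp⟩).elim
  · rintro _ rfl
    exact Relation.ReflTransGen.refl

/-- Counts the paths with `s` edges by a quantity that depends on `H` alone. The case `s = 0` is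
excluded because isolated vertices outside the image of `f` also form singleton components. -/
theorem IsPathUnion.ncard_setOf_component {V J : Type*} [Fintype J] {H : OrientedGraph V}
    {r : J → ℕ} {f : (Σ j, Fin (r j + 1)) ↪ V} (hf : H.IsPathUnion r f) {s : ℕ} (hs : s ≠ 0) :
    {a | (H.component a).ncard = s + 1}.ncard =
      (s + 1) * (Finset.univ.filter fun j => r j = s).card := by
  have h1 : {a | (H.component a).ncard = s + 1} =
      f '' ((Finset.univ.filter fun j => r j = s).sigma fun _ => Finset.univ :
        Finset (Σ j, Fin (r j + 1))) := by
    ext a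
    by_cases ha : a ∈ Set.range f
    · obtain ⟨p, rfl⟩ := ha
      simp [hf.ncard_component, f.injective.mem_set_image]
    · simp only [Set.mem_ofPred_eq, hf.component_of_notMem ha, Set.ncard_singleton]
      refine ⟨fun h => by omega, ?_⟩
      rintro ⟨p, -, rfl⟩
      exact (ha ⟨p, rfl⟩).elim
  rw [h1, Set.ncard_image_of_injective _ f.injective, Set.ncard_coe_finset, Finset.card_sigma,
    Finset.sum_congr rfl (g := fun _ => s + 1) fun j hj => ?_, Finset.sum_const, smul_eq_mul,
    mul_comm]
  rw [Finset.card_univ, Fintype.card_fin, (Finset.mem_filter.mp hj).2]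

/-- Component sizes determine the multiset of path lengths, and a sorted tuple is determined by its
multiset. Hence each edge set is counted by at most one tuple of the expansion. -/
theorem IsPathUnion.ofFn_eq {V : Type*} {H : OrientedGraph V} {k k' : ℕ} {n : Fin k → ℕ}
    {n' : Fin k' → ℕ} {f : (Σ j, Fin (2 * n j + 1)) ↪ V} {f' : (Σ j, Fin (2 * n' j + 1)) ↪ V}
    (hf : H.IsPathUnion (fun j => 2 * n j) f) (hf' : H.IsPathUnion (fun j => 2 * n' j) f')
    (hn : Monotone n) (hn' : Monotone n') (h1 : ∀ i, 1 ≤ n i) (h1' : ∀ i, 1 ≤ n' i) :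
    (⟨k, n⟩ : Σ k, Fin k → ℕ) = ⟨k', n'⟩ := by
  have hcard : ∀ s, (Finset.univ.filter fun j => n j = s).card =
      (Finset.univ.filter fun j => n' j = s).card := by
    intro s
    rcases Nat.eq_zero_or_pos s with rfl | hs
    · rw [Finset.filter_false_of_mem fun j _ => by have := h1 j; omega,
        Finset.filter_false_of_mem fun j _ => by have := h1' j; omega]
      rfl
    · have e1 := hf.ncard_setOf_component (s := 2 * s) (by omega)
      have e2 := hf'.ncard_setOf_component (s := 2 * s) (by omega)
      rw [e1] at e2
      simpa using e2
  have hperm : (List.ofFn n).Perm (List.ofFn n') := by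
    rw [← Multiset.coe_eq_coe, ← Fin.univ_val_map, ← Fin.univ_val_map]
    ext s
    simp only [Multiset.count_map]
    have := hcard s
    simp only [Finset.card, Finset.filter_val, eq_comm] at this ⊢
    exact this
  have := hperm.eq_of_sortedLE hn.sortedLE_ofFn hn'.sortedLE_ofFn
  exact List.ofFn_inj'.mp this

/-- An end vertex of a path. It serves to show that neither the whole cycle nor the edgeless graph
is such a forest. -/
theorem IsPathUnion.exists_unique_neighbour {V J : Type*} {H : OrientedGraph V} {r : J → ℕ}
    {f : (Σ j, Fin (r j + 1)) ↪ V} (hf : H.IsPathUnion r f) (j : J) (hj : 1 ≤ r j) :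
    ∃ a b, ∀ c, (H.Adj a c ∨ H.Adj c a) ↔ c = b := by
  refine ⟨f ⟨j, 0⟩, f ⟨j, ⟨1, by omega⟩⟩, fun c => ?_⟩
  rw [hf]
  constructor
  · rintro ⟨p, ⟨i, v⟩, hp, rfl, rfl, h⟩
    obtain rfl := f.injective hp
    congr 2
    ext
    simpa using h
  · rintro rfl
    exact ⟨_, _, rfl, rfl, rfl, Or.inl rfl⟩

theorem IsPathUnion.card_le {V J : Type*} [Fintype V] [Fintype J] {r : J → ℕ}
    (f : (Σ j, Fin (r j + 1)) ↪ V) : Fintype.card J + ∑ j, r j ≤ Fintype.card V := by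
  have := Fintype.card_le_of_embedding f
  simpa [Fintype.card_sigma, Finset.sum_add_distrib, add_comm] using this

/-! ### Proper edge subsets of a cycle are linear forests -/

open Classical in
-- `S i` says that the edge between `i` and `i + 1` is kept. The paths are the maximal runs of kept
-- edges, indexed by their starting points; a missing edge guarantees that every run has a start and
-- an end.
theorem exists_isPathUnion {V : Type*} {N : ℕ} [NeZero N] (e : ZMod N ≃ V) (H : OrientedGraph V)
    (S : ZMod N → Prop) (hne : ∃ i, ¬S i)
    (hH : ∀ a b, (H.Adj (e a) (e b) ∨ H.Adj (e b) (e a)) ↔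
      (S a ∧ b = a + 1) ∨ (S b ∧ a = b + 1)) :
    ∃ (r : {i // S i ∧ ¬S (i - 1)} → ℕ) (f : (Σ j, Fin (r j + 1)) ↪ V),
      (∀ j, 1 ≤ r j) ∧ H.IsPathUnion r f := by
  obtain ⟨i₀, hi₀⟩ := hne
  have hex : ∀ j : ZMod N, ∃ r : ℕ, ¬S (j + r) := fun j => by
    obtain ⟨r, hr⟩ := ZMod.natCast_zmod_surjective (i₀ - j)
    exact ⟨r, by rwa [hr, add_sub_cancel]⟩
  have hex' : ∀ j : ZMod N, ∃ r : ℕ, ¬S (j - (r + 1 : ℕ)) := fun j => by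
    obtain ⟨r, hr⟩ := ZMod.natCast_zmod_surjective (j - i₀ - 1)
    refine ⟨r, ?_⟩
    rw [Nat.cast_succ, hr]
    simpa using hi₀
  let r : {i // S i ∧ ¬S (i - 1)} → ℕ := fun j => Nat.find (hex j)
  have hr : ∀ (j) (u : ℕ), u < r j → S (j + u) := fun j u hu => not_not.mp (Nat.find_min _ hu)
  -- If two runs meet with `u < u'`, then `j - 1` is the start of a kept edge of the run from `j'`,
  -- contradicting that `j` starts a run. This gives injectivity.
  have hlt : ∀ (j j' : {i // S i ∧ ¬S (i - 1)}) (u u' : ℕ), u' ≤ r j' →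
      (j : ZMod N) + u = j' + u' → ¬u < u' := by
    intro j j' u u' hu' h hlt
    apply j.2.2
    have := hr j' (u' - u - 1) (by omega)
    rw [Nat.cast_sub (by omega), Nat.cast_sub hlt.le, Nat.cast_one] at this
    convert this using 1
    linear_combination h
  let f : (Σ j, Fin (r j + 1)) ↪ V := ⟨fun p => e (p.1 + (p.2 : ℕ)), by
    rintro ⟨j, u⟩ ⟨j', u'⟩ h
    have h := e.injective h
    simp only at h
    have h1 := hlt j j' u u' (by omega) h
    have h2 := hlt j' j u' u (by omega) h.symm
    have h3 : (u : ℕ) = u' := by omega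
    rw [h3] at h
    obtain rfl : j = j' := Subtype.ext (add_right_cancel h)
    rw [Fin.ext h3]⟩
  have hf : ∀ p, f p = e (p.1 + (p.2 : ℕ)) := fun p => rfl
  refine ⟨r, f, fun j => ?_, fun a b => ?_⟩
  · rw [Nat.one_le_iff_ne_zero]
    intro h
    have := Nat.find_spec (hex j)
    change ¬S (j + (r j : ℕ)) at this
    rw [h, Nat.cast_zero, add_zero] at this
    exact this j.2.1
  · have hrun : ∀ a, S a → ∃ p q, f p = e a ∧ f q = e (a + 1) ∧
        p.1 = q.1 ∧ q.2.val = p.2.val + 1 := by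
      intro a ha
      -- `t` is the number of kept edges that immediately precede edge `a`, so the run containing
      -- `a` starts at `a - t`; the shift in `hex'` accounts for edge `a` itself being kept.
      let t := Nat.find (hex' a)
      have hS : ∀ v ≤ t, S (a - v) := by
        intro v hv
        rcases v with _ | v
        · simpa using ha
        · exact not_not.mp (Nat.find_min (hex' a) (Nat.lt_of_succ_le hv))
      let j : {i // S i ∧ ¬S (i - 1)} := ⟨a - t, hS t le_rfl, by
        have := Nat.find_spec (hex' a)
        rwa [Nat.cast_succ, ← sub_sub] at this⟩
      have hj : t < r j := by
        rw [Nat.lt_find_iff]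
        intro u hu
        rw [not_not]
        have := hS (t - u) (by omega)
        rw [Nat.cast_sub hu] at this
        convert this using 1
        simp only [j]
        ring
      refine ⟨⟨j, ⟨t, by omega⟩⟩, ⟨j, ⟨t + 1, by omega⟩⟩, ?_, ?_, rfl, rfl⟩
      · rw [hf]
        simp [j]
      · rw [hf]
        simp only [j]
        congr 1
        push_cast
        ring
    obtain ⟨a, rfl⟩ := e.surjective a
    obtain ⟨b, rfl⟩ := e.surjective b
    rw [hH]
    constructor
    · rintro (⟨h, rfl⟩ | ⟨h, rfl⟩)
      · obtain ⟨p, q, h1, h2, h3, h4⟩ := hrun a h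
        exact ⟨p, q, h1, h2, h3, Or.inl h4⟩
      · obtain ⟨p, q, h1, h2, h3, h4⟩ := hrun b h
        exact ⟨q, p, h2, h1, h3.symm, Or.inr h4⟩
    · have hstep : ∀ p q : Σ j, Fin (r j + 1), p.1 = q.1 → q.2.val = p.2.val + 1 →
          S (p.1 + (p.2 : ℕ)) ∧ ((q.1 : ZMod N) + (q.2 : ℕ)) = (p.1 + (p.2 : ℕ)) + 1 := by
        rintro ⟨i, u⟩ ⟨j, v⟩ hij huv
        obtain rfl : i = j := hij
        simp only at huv ⊢
        refine ⟨hr _ _ (by omega), ?_⟩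
        rw [huv]
        push_cast
        ring
      rintro ⟨p, q, h1, h2, h3, h4⟩
      obtain rfl := e.injective h1
      obtain rfl := e.injective h2
      rcases h4 with h4 | h4
      · exact Or.inl (hstep p q h3 h4)
      · exact Or.inr (hstep q p h3.symm h4)

/-! ### Expansion of the density of a cycle orientation -/

theorem spanning_edges {V : Type*} [Fintype V] (G : OrientedGraph V) {F : Finset (V × V)}
    (hF : F ⊆ G.edges) : (G.spanning F).edges = F := by
  ext e
  simp only [mem_edges, spanning]
  exact ⟨fun h => h.2, fun h => ⟨(mem_edges G e).mp (hF h), h⟩⟩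

open Classical in
/-- The sign with which `H` counts as a reversal of a disjoint union of paths. -/
noncomputable def reversalSign {V : Type*} (H : OrientedGraph V) {k : ℕ} (n : Fin k → ℕ) : ℝ :=
  (if H.EvenReversal (disjUnion fun i => pathQ (n i)) then 1 else 0) -
    (if H.OddReversal (disjUnion fun i => pathQ (n i)) then 1 else 0)

theorem alpha_eq_sum {V : Type*} [Fintype V] (C : OrientedGraph V) {k : ℕ} (n : Fin k → ℕ) :
    (C.alpha n : ℝ) = ∑ F ∈ C.edges.powerset, (C.spanning F).reversalSign n := by
  simp only [alpha, reversalSign, Finset.sum_sub_distrib, Finset.sum_boole]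
  push_cast
  rfl

/-- `H` is a reversal of the disjoint union of the paths `Q_{2 n i}` with isolated vertices. -/
def IsReversal {V : Type*} (H : OrientedGraph V) {k : ℕ} (n : Fin k → ℕ) : Prop :=
  H.EvenReversal (disjUnion fun i => pathQ (n i)) ∨ H.OddReversal (disjUnion fun i => pathQ (n i))

open Classical in
-- No uniqueness of the parity is needed: if both parities occur, the sign is 0, and the density
-- equals its own negative.
theorem reversalSign_mul_prod {V : Type*} [Fintype V] (H : OrientedGraph V) {k : ℕ}
    (n : Fin k → ℕ) {A : I → I → ℝ} (hA : IsKernel A) (hanti : ∀ x y, A x y = -A y x) :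
    H.reversalSign n * ∏ i, pathNorm A (n i) = if H.IsReversal n then H.homDensity A else 0 := by
  have hd : (disjUnion fun i => pathQ (n i)).homDensity A = ∏ i, pathNorm A (n i) := by
    rw [homDensity_disjUnion]
    simp only [homDensity_pathQ hA hanti]
  simp only [reversalSign, IsReversal]
  by_cases h1 : H.EvenReversal (disjUnion fun i => pathQ (n i)) <;>
    by_cases h2 : H.OddReversal (disjUnion fun i => pathQ (n i))
  · have e1 := h1.homDensity_eq hA hanti
    have e2 := h2.homDensity_eq hA hanti
    simp only [h1, h2, if_true, or_self, sub_self, zero_mul]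
    linarith
  · simp [h1, h2, h1.homDensity_eq hA hanti, hd]
  · simp [h1, h2, h2.homDensity_eq hA hanti, hd]
  · simp [h1, h2]

theorem IsReversal.exists_embedding {V : Type*} {H : OrientedGraph V} {k : ℕ} {n : Fin k → ℕ}
    (h : H.IsReversal n) : ∃ f, H.IsPathUnion (fun j => 2 * n j) f :=
  IsPathUnion.of_reversal h

theorem IsPathUnion.exists_isReversal {V J : Type*} [Fintype J] {H : OrientedGraph V}
    {n : J → ℕ} {f : (Σ j, Fin (2 * n j + 1)) ↪ V} (hf : H.IsPathUnion (fun j => 2 * n j) f) :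
    ∃ τ : Fin (Fintype.card J) ≃ J, Monotone (n ∘ τ) ∧ H.IsReversal (n ∘ τ) := by
  let g := n ∘ (Fintype.equivFin J).symm
  let τ : Fin (Fintype.card J) ≃ J := (Tuple.sort g).trans (Fintype.equivFin J).symm
  refine ⟨τ, Tuple.monotone_sort g, ?_⟩
  let s : (Σ i, Fin (2 * (n ∘ τ) i + 1)) ≃ Σ j, Fin (2 * n j + 1) :=
    Equiv.sigmaCongrLeft (β := fun j => Fin (2 * n j + 1)) τ
  refine evenReversal_or_oddReversal (s.toEmbedding.trans f) fun a b => ?_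
  rw [hf]
  have hs : ∀ p q, PathAdj (r := fun j => 2 * n j) (s p) (s q) ↔
      PathAdj (r := fun i => 2 * (n ∘ τ) i) p q := by
    rintro ⟨i, u⟩ ⟨j, v⟩
    refine and_congr ?_ Iff.rfl
    exact τ.injective.eq_iff
  constructor
  · rintro ⟨p, q, rfl, rfl, h⟩
    refine ⟨s.symm p, s.symm q, by simp, by simp, ?_⟩
    rwa [disjUnion_pathQ_adj, ← hs, s.apply_symm_apply, s.apply_symm_apply]
  · rintro ⟨p, q, rfl, rfl, h⟩
    exact ⟨s p, s q, rfl, rfl, by rwa [hs, ← disjUnion_pathQ_adj]⟩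

theorem IsPathUnion.homDensity_eq_zero {V J : Type*} [Fintype V] [Fintype J] {H : OrientedGraph V}
    {r : J → ℕ} {f : (Σ j, Fin (r j + 1)) ↪ V} (hf : H.IsPathUnion r f) {A : I → I → ℝ}
    (hA : IsKernel A) (hanti : ∀ x y, A x y = -A y x) {j : J} (hj : Odd (r j)) :
    H.homDensity A = 0 := by
  have h0 : (disjUnion fun j => directedPath (r j)).homDensity A = 0 := by
    rw [homDensity_disjUnion]
    exact Finset.prod_eq_zero (Finset.mem_univ j) (homDensity_directedPath_of_odd hA hanti hj)
  rcases evenReversal_or_oddReversal (G := disjUnion fun j => directedPath (r j)) f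
    (fun a b => by simpa only [disjUnion_directedPath_adj] using hf a b) with h | h
  · rw [h.homDensity_eq hA hanti, h0]
  · rw [h.homDensity_eq hA hanti, h0, neg_zero]

theorem IsCycleOrientation.exists_equiv {V : Type*} {C : OrientedGraph V} {ℓ : ℕ}
    (hC : C.IsCycleOrientation ℓ) :
    ∃ e : ZMod ℓ ≃ V, ∀ a b, (C.Adj (e a) (e b) ∨ C.Adj (e b) (e a)) ↔ b = a + 1 ∨ a = b + 1 := by
  obtain ⟨hℓ, ⟨φ⟩⟩ := hC
  obtain ⟨m, rfl⟩ := Nat.exists_eq_add_of_le' hℓ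
  refine ⟨φ.symm.toEquiv, fun a b => ?_⟩
  have h : C.underlying.Adj (φ.symm a) (φ.symm b) ↔ (SimpleGraph.cycleGraph (m + 3)).Adj a b :=
    φ.symm.map_adj_iff
  refine h.trans (SimpleGraph.cycleGraph_adj.trans ?_)
  -- `Fin (m + 3)` and `ZMod (m + 3)` agree by definition.
  change ((a : ZMod (m + 3)) - b = 1 ∨ (b : ZMod (m + 3)) - a = 1) ↔ _
  rw [sub_eq_iff_eq_add', sub_eq_iff_eq_add', or_comm]

theorem IsCycleOrientation.exists_isPathUnion {V : Type*} [Fintype V] {C : OrientedGraph V} {ℓ : ℕ}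
    (hC : C.IsCycleOrientation ℓ) {F : Finset (V × V)} (hF : F ⊂ C.edges) :
    ∃ (J : Type) (_ : Fintype J) (r : J → ℕ) (f : (Σ j, Fin (r j + 1)) ↪ V),
      (∀ j, 1 ≤ r j) ∧ (C.spanning F).IsPathUnion r f := by
  classical
  obtain ⟨e, he⟩ := hC.exists_equiv
  have : NeZero ℓ := ⟨by have := hC.1; omega⟩
  let H := C.spanning F
  have hHC : ∀ u v, H.Adj u v → C.Adj u v := fun u v h => h.1
  have hne : ∃ i, ¬(H.Adj (e i) (e (i + 1)) ∨ H.Adj (e (i + 1)) (e i)) := by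
    obtain ⟨⟨u, v⟩, huv, hF'⟩ := Finset.exists_of_ssubset hF
    rw [mem_edges] at huv
    have hn : ¬(H.Adj u v ∨ H.Adj v u) := by
      rintro (h | h)
      · exact hF' h.2
      · exact C.asymm _ _ huv (hHC _ _ h)
    obtain ⟨a, rfl⟩ := e.surjective u
    obtain ⟨b, rfl⟩ := e.surjective v
    rcases (he a b).mp (Or.inl huv) with rfl | rfl
    · exact ⟨a, hn⟩
    · exact ⟨b, fun h => hn h.symm⟩
  obtain ⟨r, f, h1, h2⟩ := OrientedGraph.exists_isPathUnion e H _ hne fun a b => by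
    constructor
    · intro h
      rcases (he a b).mp (h.imp (hHC _ _) (hHC _ _)) with rfl | rfl
      · exact Or.inl ⟨h, rfl⟩
      · exact Or.inr ⟨h.symm, rfl⟩
    · rintro (⟨h, rfl⟩ | ⟨h, rfl⟩)
      · exact h
      · exact h.symm
  exact ⟨_, inferInstance, r, f, h1, h2⟩

theorem IsCycleOrientation.not_isReversal {V : Type*} {C : OrientedGraph V} {ℓ : ℕ}
    (hC : C.IsCycleOrientation ℓ) {k : ℕ} {n : Fin k → ℕ} (hk : 1 ≤ k) (hn : ∀ i, 1 ≤ n i) :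
    ¬C.IsReversal n := by
  intro h
  obtain ⟨f, hf⟩ := h.exists_embedding
  obtain ⟨e, he⟩ := hC.exists_equiv
  have := hn ⟨0, hk⟩
  obtain ⟨u, v, huv⟩ := hf.exists_unique_neighbour ⟨0, hk⟩ (by omega)
  obtain ⟨a, rfl⟩ := e.surjective u
  have h1 := (huv _).mp ((he a (a + 1)).mpr (Or.inl rfl))
  have h2 := (huv _).mp ((he a (a - 1)).mpr (Or.inr (by ring)))
  -- A cycle vertex has the neighbours `a + 1` and `a - 1`; if they coincide then `ℓ` divides 2,
  -- contrary to `3 ≤ ℓ`.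
  have h3 := e.injective (h1.trans h2.symm)
  have h4 : ((2 : ℕ) : ZMod ℓ) = 0 := by
    push_cast
    linear_combination h3
  rw [ZMod.natCast_eq_zero_iff] at h4
  have := Nat.le_of_dvd (by norm_num) h4
  have := hC.1
  omega

theorem not_isReversal_of_edges_eq_empty {V : Type*} {H : OrientedGraph V}
    (hH : ∀ u v, ¬H.Adj u v) {k : ℕ} {n : Fin k → ℕ} (hk : 1 ≤ k) (hn : ∀ i, 1 ≤ n i) :
    ¬H.IsReversal n := by
  intro h
  obtain ⟨f, hf⟩ := h.exists_embedding
  have := hn ⟨0, hk⟩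
  obtain ⟨u, v, huv⟩ := hf.exists_unique_neighbour ⟨0, hk⟩ (by omega)
  exact ((huv v).mpr rfl).elim (hH _ _) (hH _ _)

/-- The tuples `1 ≤ n_1 ≤ ⋯ ≤ n_k` with `k ≥ 1` that correspond to a linear forest with at most
`ℓ` vertices, and possibly some more. -/
def IsTupleSet (ℓ : ℕ) (T : Finset (Σ k, Fin k → ℕ)) : Prop :=
  (∀ p ∈ T, 1 ≤ p.1 ∧ Monotone p.2 ∧ ∀ i, 1 ≤ p.2 i) ∧
  ∀ p : Σ k, Fin k → ℕ, 1 ≤ p.1 → Monotone p.2 → (∀ i, 1 ≤ p.2 i) →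
    p.1 + ∑ i, 2 * p.2 i ≤ ℓ → p ∈ T

theorem IsCycleOrientation.card_eq {V : Type*} [Fintype V] {C : OrientedGraph V} {ℓ : ℕ}
    (hC : C.IsCycleOrientation ℓ) : Fintype.card V = ℓ := by
  obtain ⟨-, ⟨φ⟩⟩ := hC
  simpa using Fintype.card_congr φ.toEquiv

/-- If the density is nonzero, all paths of the forest have even length, and exactly one tuple of
`T` describes it. If the density is 0, every term vanishes. Superfluous tuples in `T` are harmless.
-/
theorem IsCycleOrientation.sum_reversalSign {V : Type*} [Fintype V] {C : OrientedGraph V} {ℓ : ℕ}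
    (hC : C.IsCycleOrientation ℓ) {T : Finset (Σ k, Fin k → ℕ)} (hT : IsTupleSet ℓ T)
    {A : I → I → ℝ} (hA : IsKernel A) (hanti : ∀ x y, A x y = -A y x) {F : Finset (V × V)}
    (hF : F ⊂ C.edges) (hne : F.Nonempty) :
    ∑ p ∈ T, (C.spanning F).reversalSign p.2 * ∏ i, pathNorm A (p.2 i) =
      (C.spanning F).homDensity A := by
  classical
  simp only [reversalSign_mul_prod _ _ hA hanti]
  by_cases h0 : (C.spanning F).homDensity A = 0
  · simp [h0]
  obtain ⟨J, _, r, f, hr, hf⟩ := hC.exists_isPathUnion hF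
  have heven : ∀ j, ∃ m, r j = 2 * m := fun j => by
    rcases Nat.even_or_odd (r j) with h | h
    · obtain ⟨m, hm⟩ := h
      exact ⟨m, by omega⟩
    · exact (h0 (hf.homDensity_eq_zero hA hanti h)).elim
  choose n hn using heven
  obtain rfl : r = fun j => 2 * n j := funext hn
  obtain ⟨τ, hmono, hrev⟩ := hf.exists_isReversal
  have hn1 : ∀ j, 1 ≤ n j := fun j => by
    have := hr j
    simp only at this
    omega
  have hmem : (⟨_, n ∘ τ⟩ : Σ k, Fin k → ℕ) ∈ T := by
    refine hT.2 _ ?_ hmono (fun i => hn1 _) ?_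
    · obtain ⟨⟨u, v⟩, huv⟩ := hne
      have h1 : (C.spanning F).Adj u v := ⟨(mem_edges C (u, v)).mp (hF.1 huv), huv⟩
      obtain ⟨p, -⟩ := (hf u v).mp (Or.inl h1)
      exact Fintype.card_pos_iff.mpr ⟨p.1⟩
    · have := IsPathUnion.card_le f
      rw [hC.card_eq] at this
      simp only [Function.comp]
      rwa [Equiv.sum_comp τ fun j => 2 * n j]
  rw [Finset.sum_eq_single_of_mem _ hmem, if_pos hrev]
  intro p hp hpne
  rw [if_neg]
  intro hp'
  obtain ⟨f', hf'⟩ := hp'.exists_embedding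
  obtain ⟨f'', hf''⟩ := hrev.exists_embedding
  obtain ⟨-, h2, h3⟩ := hT.1 p hp
  exact hpne (hf'.ofFn_eq hf'' h2 hmono h3 fun i => hn1 _)

theorem homDensity_eq_sum {V : Type*} [Fintype V] (C : OrientedGraph V) {A W : I → I → ℝ}
    (hA : IsKernel A) (hW : ∀ x y, W x y = 1 / 2 * (1 + A x y)) :
    C.homDensity W = 1 / 2 ^ C.edges.card *
      ∑ F ∈ C.edges.powerset, (C.spanning F).homDensity A := by
  have h : ∀ F ∈ C.edges.powerset, (C.spanning F).homDensity A =
      ∫ x : V → I, ∏ e ∈ F, A (x e.1) (x e.2) := fun F hF => by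
    rw [homDensity, spanning_edges C (Finset.mem_powerset.mp hF)]
  rw [Finset.sum_congr rfl h, ← integral_finsetSum _ fun F _ => hA.integrable_prod F,
    ← integral_const_mul, homDensity]
  congr 1 with x
  simp only [hW]
  rw [Finset.prod_mul_distrib, Finset.prod_const, Finset.prod_one_add, one_div_pow]

theorem IsCycleOrientation.homDensity_eq {V : Type*} [Fintype V] {C : OrientedGraph V} {ℓ : ℕ}
    (hC : C.IsCycleOrientation ℓ) {T : Finset (Σ k, Fin k → ℕ)} (hT : IsTupleSet ℓ T)
    {A W : I → I → ℝ} (hA : IsKernel A) (hanti : ∀ x y, A x y = -A y x)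
    (hW : ∀ x y, W x y = 1 / 2 * (1 + A x y)) :
    C.homDensity W = 1 / 2 ^ C.edges.card *
      (1 + C.homDensity A + ∑ p ∈ T, (C.alpha p.2 : ℝ) * ∏ i, pathNorm A (p.2 i)) := by
  classical
  have hne : (∅ : Finset (V × V)) ≠ C.edges := by
    obtain ⟨e, he⟩ := hC.exists_equiv
    intro h
    rcases (he 0 (0 + 1)).mpr (Or.inl rfl) with h' | h'
    · have := (mem_edges C (_, _)).mpr h'
      rw [← h] at this
      simp at this
    · have := (mem_edges C (_, _)).mpr h'
      rw [← h] at this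
      simp at this
  rw [homDensity_eq_sum C hA hW]
  congr 1
  have hfull : ∀ u v, (C.spanning C.edges).Adj u v ↔ C.Adj u v := fun u v =>
    ⟨fun h => h.1, fun h => ⟨h, (mem_edges C (u, v)).mpr h⟩⟩
  have hfull' : C.spanning C.edges = C := by
    cases C
    simp only [spanning, mk.injEq]
    ext u v
    exact hfull u v
  -- The empty set, the full edge set and the proper nonempty sets give the three kinds of terms;
  -- the tuple sum vanishes in the first two cases.
  have key : ∀ F ∈ C.edges.powerset, (C.spanning F).homDensity A =
      (if F = ∅ then 1 else 0) + (if F = C.edges then C.homDensity A else 0) +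
        ∑ p ∈ T, (C.spanning F).reversalSign p.2 * ∏ i, pathNorm A (p.2 i) := by
    intro F hF
    rw [Finset.mem_powerset] at hF
    by_cases h1 : F = ∅
    · subst h1
      rw [if_pos rfl, if_neg hne, Finset.sum_eq_zero]
      · rw [homDensity, spanning_edges C hF]
        simp
      · intro p hp
        obtain ⟨h1, -, h3⟩ := hT.1 p hp
        rw [reversalSign_mul_prod _ _ hA hanti, if_neg]
        exact not_isReversal_of_edges_eq_empty (fun u v h => by simpa using h.2) h1 h3
    · by_cases h2 : F = C.edges
      · subst h2
        rw [if_neg h1, if_pos rfl, Finset.sum_eq_zero, hfull']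
        · ring
        · intro p hp
          obtain ⟨h1, -, h3⟩ := hT.1 p hp
          rw [reversalSign_mul_prod _ _ hA hanti, if_neg]
          rw [hfull']
          exact hC.not_isReversal h1 h3
      · rw [if_neg h1, if_neg h2, hC.sum_reversalSign hT hA hanti
          (Finset.ssubset_iff_subset_ne.mpr ⟨hF, h2⟩) (Finset.nonempty_iff_ne_empty.mpr h1)]
        ring
  rw [Finset.sum_congr rfl key, Finset.sum_add_distrib, Finset.sum_add_distrib, Finset.sum_comm]
  congr 1
  · rw [Finset.sum_ite_eq' _ ∅, Finset.sum_ite_eq' _ C.edges,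
      if_pos (Finset.empty_mem_powerset _), if_pos (Finset.mem_powerset_self _)]
  · refine Finset.sum_congr rfl fun p _ => ?_
    rw [alpha_eq_sum, Finset.sum_mul]

theorem IsCycleOrientation.reversal_cycleD {V : Type*} [Fintype V] {C : OrientedGraph V} {j : ℕ}
    (hC : C.IsCycleOrientation (2 * (j + 1))) :
    C.EvenReversal (cycleD (j + 1)) ∨ C.OddReversal (cycleD (j + 1)) := by
  obtain ⟨e, he⟩ := hC.exists_equiv
  have hj : 1 ≤ j := by have := hC.1; omega
  let e' : Fin (2 * j + 1 + 1) ≃ V := e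
  have he' : ∀ a b : Fin (2 * j + 1 + 1),
      (C.Adj (e' a) (e' b) ∨ C.Adj (e' b) (e' a)) ↔ b = a + 1 ∨ a = b + 1 := he
  have hD : ∀ a b : Fin (2 * j + 1 + 1), (b = a + 1 ∨ a = b + 1) ↔
      ((cycleD (j + 1)).Adj a b ∨ (cycleD (j + 1)).Adj b a) := by
    intro a b
    change _ ↔ ((a.val < j + 1 ∧ b.val = a.val + 1) ∨ (j + 1 ≤ b.val ∧ a.val = b.val + 1) ∨
      (a.val = 0 ∧ b.val + 1 = 2 * (j + 1))) ∨ ((b.val < j + 1 ∧ a.val = b.val + 1) ∨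
      (j + 1 ≤ a.val ∧ b.val = a.val + 1) ∨ (b.val = 0 ∧ a.val + 1 = 2 * (j + 1)))
    rw [Fin.ext_iff, Fin.ext_iff, Fin.val_add_one, Fin.val_add_one]
    simp only [Fin.ext_iff, Fin.val_last]
    split_ifs <;> omega
  refine evenReversal_or_oddReversal e'.toEmbedding fun u v => ?_
  obtain ⟨a, rfl⟩ := e'.surjective u
  obtain ⟨b, rfl⟩ := e'.surjective v
  rw [he', hD]
  constructor
  · intro h
    exact ⟨a, b, rfl, rfl, h⟩
  · rintro ⟨a', b', h1, h2, h⟩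
    obtain rfl : a' = a := e'.injective h1
    obtain rfl : b' = b := e'.injective h2
    exact h

theorem IsCycleOrientation.homDensity_eq_gamma {V : Type*} [Fintype V] {C : OrientedGraph V} {j : ℕ}
    (hC : C.IsCycleOrientation (2 * (j + 1))) {A : I → I → ℝ} (hA : IsKernel A)
    (hanti : ∀ x y, A x y = -A y x) : C.homDensity A = C.gamma * cycleNorm A j := by
  have hj : 1 ≤ j := by have := hC.1; omega
  have hc : Fintype.card V / 2 = j + 1 := by rw [hC.card_eq]; omega
  have hD := homDensity_cycleD hA hanti j hj
  by_cases h : C.EvenReversal (cycleD (j + 1))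
  · have hγ : C.gamma = 1 := by
      rw [gamma, hc]
      exact if_pos h
    rw [hγ, h.homDensity_eq hA hanti, hD]
    simp
  · have hγ : C.gamma = -1 := by
      rw [gamma, hc]
      exact if_neg h
    rw [hγ, (hC.reversal_cycleD.resolve_left h).homDensity_eq hA hanti, hD]
    simp

/-! ### The index set and the numerical bounds -/

open Classical in
/-- The index set of the expansion of the density of a cycle. -/
noncomputable def pathTuples (ℓ : ℕ) : Finset (Σ k, Fin k → ℕ) :=
  ((Finset.Icc 1 (ℓ / 2 - 1)).image fun n => ⟨1, ![n]⟩) ∪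
    ({⟨2, ![1, 1]⟩} ∪ (Finset.Icc 2 ℓ).sigma (tuples ℓ))

theorem mem_tuples {ℓ k : ℕ} {n : Fin k → ℕ} : n ∈ tuples ℓ k ↔
    (∀ i, 1 ≤ n i ∧ n i ≤ ℓ) ∧ Monotone n ∧ 6 < k + ∑ i, 2 * n i ∧ k + ∑ i, 2 * n i ≤ ℓ := by
  simp [tuples]

theorem isTupleSet_pathTuples {ℓ : ℕ} (hℓ : Even ℓ) : IsTupleSet ℓ (pathTuples ℓ) := by
  constructor
  · intro p hp
    simp only [pathTuples, Finset.mem_union, Finset.mem_image, Finset.mem_Icc,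
      Finset.mem_singleton, Finset.mem_sigma, mem_tuples] at hp
    rcases hp with ⟨m, hm, rfl⟩ | rfl | ⟨h1, h2, h3, -⟩
    · exact ⟨le_rfl, Subsingleton.monotone _, fun i => by simpa using hm.1⟩
    · refine ⟨one_le_two, fun i j _ => ?_, fun i => ?_⟩
      · fin_cases i <;> fin_cases j <;> simp
      · fin_cases i <;> simp
    · exact ⟨by omega, h3, fun i => (h2 i).1⟩
  · rintro ⟨k, n⟩ hk hmono h1 hle
    simp only at hk hmono h1 hle
    simp only [pathTuples, Finset.mem_union, Finset.mem_image, Finset.mem_Icc,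
      Finset.mem_singleton, Finset.mem_sigma, mem_tuples]
    have hi : ∀ i, 2 * n i ≤ ∑ i, 2 * n i := fun i =>
      Finset.single_le_sum (f := fun i => 2 * n i) (fun _ _ => Nat.zero_le _) (Finset.mem_univ i)
    have hsum : 2 * k ≤ ∑ i, 2 * n i := by
      have := Finset.sum_le_sum (s := Finset.univ) fun (i : Fin k) _ =>
        Nat.mul_le_mul_left 2 (h1 i)
      simp only [Finset.sum_const, Finset.card_univ, Fintype.card_fin, smul_eq_mul] at this
      omega
    rcases Nat.lt_or_ge k 2 with hk2 | hk2
    · left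
      obtain rfl : k = 1 := by omega
      rw [Fin.sum_univ_one] at hle
      obtain ⟨m, rfl⟩ := hℓ
      refine ⟨n 0, ⟨h1 0, by omega⟩, ?_⟩
      congr 1
      ext i
      fin_cases i
      rfl
    · right
      -- Since `3 * k ≤ k + ∑ 2 n_i`, a total of at most 6 with `k ≥ 2` leaves only the pair `(1,
      -- 1)`.
      by_cases h6 : 6 < k + ∑ i, 2 * n i
      · exact Or.inr ⟨⟨hk2, by omega⟩, fun i => ⟨h1 i, by have := hi i; omega⟩, hmono, h6, hle⟩
      · left
        obtain rfl : k = 2 := by omega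
        rw [Fin.sum_univ_two] at h6
        have h0 := h1 0
        have h1 := h1 1
        congr 1
        ext i
        fin_cases i
        · change n 0 = 1
          omega
        · change n 1 = 1
          omega

theorem sum_pathTuples {ℓ : ℕ} (hℓ : 4 ≤ ℓ) (g : (Σ k, Fin k → ℕ) → ℝ) :
    ∑ p ∈ pathTuples ℓ, g p =
      (g ⟨1, ![1]⟩ + ∑ m ∈ Finset.Icc 2 (ℓ / 2 - 1), g ⟨1, ![m]⟩) +
        (g ⟨2, ![1, 1]⟩ + ∑ k ∈ Finset.Icc 2 ℓ, ∑ n ∈ tuples ℓ k, g ⟨k, n⟩) := by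
  classical
  rw [pathTuples, Finset.sum_union, Finset.sum_union, Finset.sum_singleton, Finset.sum_sigma,
    Finset.sum_image]
  · congr 1
    rw [← Finset.insert_Icc_add_one_left_eq_Icc (by omega : 1 ≤ ℓ / 2 - 1), Finset.sum_insert (by simp)]
    simp
  · intro m _ m' _ h
    simpa using h
  · rw [Finset.disjoint_singleton_left, Finset.mem_sigma, mem_tuples]
    rintro ⟨-, -, -, h, -⟩
    simp [Fin.sum_univ_two] at h
  · rw [Finset.disjoint_left]
    intro p hp hp'
    simp only [Finset.mem_union, Finset.mem_image, Finset.mem_Icc,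
      Finset.mem_singleton, Finset.mem_sigma] at hp hp'
    obtain ⟨m, hm, rfl⟩ := hp
    rcases hp' with h | ⟨h, -⟩
    · simpa using congrArg Sigma.fst h
    · simp at h

/-- Terms with nonnegative coefficient are bounded below by 0; only negative coefficients use the
upper bound `P`. -/
theorem min_mul_le {b p P : ℝ} (hp : 0 ≤ p) (hP : p ≤ P) : min 0 b * P ≤ b * p :=
  (mul_le_mul_of_nonpos_left hP (min_le_left 0 b)).trans
    (mul_le_mul_of_nonneg_right (min_le_right 0 b) hp)

section Bounds

variable {A : I → I → ℝ}

theorem pathNorm_le (hA : IsKernel A) (hanti : ∀ x y, A x y = -A y x)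
    (hA1 : ∀ x y, |A x y| ≤ 1) {n : ℕ} (hn : 1 ≤ n) :
    pathNorm A n ≤ (4 / Real.pi ^ 2) ^ (n - 1) * pathNorm A 1 := by
  obtain ⟨m, rfl⟩ := Nat.exists_eq_add_of_le' hn
  exact pathNorm_succ_le hA hanti hA1 m

theorem four_div_pi_sq_pow (d : ℕ) : (4 / Real.pi ^ 2) ^ d = 2 ^ (2 * d) / Real.pi ^ (2 * d) := by
  rw [div_pow, ← pow_mul, pow_mul 2 2 d]
  norm_num

theorem pathNorm_le' (hA : IsKernel A) (hanti : ∀ x y, A x y = -A y x)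
    (hA1 : ∀ x y, |A x y| ≤ 1) {n ℓ : ℕ} (hn : 1 ≤ n) (hℓ : 2 * n ≤ ℓ) :
    pathNorm A n ≤
      2 ^ (ℓ - 2) * pathNorm A 1 / (Real.pi ^ (2 * n - 2) * 2 ^ (ℓ - 2 * n)) := by
  refine (pathNorm_le hA hanti hA1 hn).trans_eq ?_
  obtain ⟨m, rfl⟩ := Nat.exists_eq_add_of_le' hn
  obtain ⟨f, rfl⟩ := Nat.exists_eq_add_of_le hℓ
  have hpi := Real.pi_ne_zero
  rw [four_div_pi_sq_pow, show m + 1 - 1 = m by omega, show 2 * (m + 1) - 2 = 2 * m by omega,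
    show 2 * (m + 1) + f - 2 = 2 * m + f by omega, Nat.add_sub_cancel_left, pow_add]
  field_simp

/-- Two factors `pathNorm A 1` are kept and the other `k - 2` are bounded by `1/3`. The base 12 is
`3 * 4`: the 4 arises when the powers of 2 are rewritten relative to `2 ^ (ℓ - 4)`. -/
theorem prod_pathNorm_le (hA : IsKernel A) (hanti : ∀ x y, A x y = -A y x)
    (hA1 : ∀ x y, |A x y| ≤ 1) {k ℓ : ℕ} {n : Fin k → ℕ} (hk : 2 ≤ k) (hn : ∀ i, 1 ≤ n i)
    (hℓ : ∑ i, 2 * n i ≤ ℓ) :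
    ∏ i, pathNorm A (n i) ≤ 2 ^ (ℓ - 4) * pathNorm A 1 ^ 2 /
      (12 ^ (k - 2) * Real.pi ^ ((∑ i, 2 * n i) - 2 * k) * 2 ^ (ℓ - ∑ i, 2 * n i)) := by
  have hpi := Real.pi_ne_zero
  have h0 := pathNorm_nonneg A 1
  have hsum : ∑ i, 2 * n i = 2 * ∑ i, (n i - 1) + 2 * k := by
    have : ∀ i, 2 * n i = 2 * (n i - 1) + 2 := fun i => by have := hn i; omega
    simp only [this, Finset.sum_add_distrib, ← Finset.mul_sum]
    simp [mul_comm]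
  calc ∏ i, pathNorm A (n i)
      ≤ ∏ i, ((4 / Real.pi ^ 2) ^ (n i - 1) * pathNorm A 1) :=
        Finset.prod_le_prod (fun i _ => pathNorm_nonneg A _) fun i _ =>
          pathNorm_le hA hanti hA1 (hn i)
    _ = (4 / Real.pi ^ 2) ^ (∑ i, (n i - 1)) * (pathNorm A 1 ^ 2 * pathNorm A 1 ^ (k - 2)) := by
        rw [Finset.prod_mul_distrib, Finset.prod_pow_eq_pow_sum, Finset.prod_const, ← pow_add,
          Finset.card_univ, Fintype.card_fin, Nat.add_sub_cancel' hk]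
    _ ≤ (4 / Real.pi ^ 2) ^ (∑ i, (n i - 1)) * (pathNorm A 1 ^ 2 * (1 / 3) ^ (k - 2)) := by
        gcongr
        exact pathNorm_one_le hA hanti hA1
    _ = _ := by
        obtain ⟨e, rfl⟩ := Nat.exists_eq_add_of_le hk
        obtain ⟨f, rfl⟩ := Nat.exists_eq_add_of_le hℓ
        rw [hsum]
        generalize ∑ i, (n i - 1) = d
        rw [four_div_pi_sq_pow, Nat.add_sub_cancel_left, Nat.add_sub_cancel,
          Nat.add_sub_cancel_left, show 2 * d + 2 * (2 + e) + f - 4 = 2 * d + 2 * e + f by omega,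
          pow_add, pow_add, show (12 : ℝ) = 2 ^ 2 * 3 by norm_num, mul_pow, ← pow_mul,
          one_div_pow]
        field_simp

/-- `h1` multiplied by `2 ^ (ℓ - 2) * pathNorm A 1` bounds the one-path terms from below, and `h2`
multiplied by `2 ^ (ℓ - 4) * pathNorm A 1 ^ 2` bounds the terms with at least two paths. -/
theorem sum_pathTuples_nonneg (hA : IsKernel A) (hanti : ∀ x y, A x y = -A y x)
    (hA1 : ∀ x y, |A x y| ≤ 1) {ℓ : ℕ} (hℓ : 4 ≤ ℓ) (a : ∀ {k : ℕ}, (Fin k → ℕ) → ℝ)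
    (h1 : 0 ≤ a ![1] / 2 ^ (ℓ - 2) + ∑ n₁ ∈ Finset.Icc 2 (ℓ / 2 - 1),
      min 0 (a ![n₁]) / (Real.pi ^ (2 * n₁ - 2) * 2 ^ (ℓ - 2 * n₁)))
    (h2 : 0 ≤ a ![1, 1] / 2 ^ (ℓ - 4) + ∑ k ∈ Finset.Icc 2 ℓ, ∑ n ∈ tuples ℓ k,
      min 0 (a n) /
        (12 ^ (k - 2) * Real.pi ^ ((∑ i, 2 * n i) - 2 * k) * 2 ^ (ℓ - ∑ i, 2 * n i))) :
    0 ≤ ∑ p ∈ pathTuples ℓ, a p.2 * ∏ i, pathNorm A (p.2 i) := by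
  have hq := pathNorm_nonneg A 1
  rw [sum_pathTuples hℓ]
  refine add_nonneg ?_ ?_
  · refine (mul_nonneg (mul_nonneg (by positivity : (0 : ℝ) ≤ 2 ^ (ℓ - 2)) hq) h1).trans ?_
    rw [mul_add, Finset.mul_sum]
    refine add_le_add (le_of_eq ?_) (Finset.sum_le_sum fun m hm => ?_)
    · simp only [Fin.prod_univ_one, Matrix.cons_val_fin_one]
      field_simp
    · rw [Finset.mem_Icc] at hm
      simp only [Fin.prod_univ_one, Matrix.cons_val_fin_one]
      refine le_trans (le_of_eq ?_) (min_mul_le (pathNorm_nonneg A m)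
        (pathNorm_le' hA hanti hA1 (by omega : 1 ≤ m) (by omega : 2 * m ≤ ℓ)))
      ring
  · refine (mul_nonneg (mul_nonneg (by positivity : (0 : ℝ) ≤ 2 ^ (ℓ - 4))
      (sq_nonneg (pathNorm A 1))) h2).trans ?_
    rw [mul_add, Finset.mul_sum]
    refine add_le_add (le_of_eq ?_) (Finset.sum_le_sum fun k hk => ?_)
    · simp only [Fin.prod_univ_two, Matrix.cons_val_zero, Matrix.cons_val_one]
      field_simp
    · rw [Finset.mul_sum]
      refine Finset.sum_le_sum fun n hn => ?_
      rw [mem_tuples] at hn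
      obtain ⟨hn1, -, -, hn2⟩ := hn
      refine le_trans (le_of_eq ?_) (min_mul_le (Finset.prod_nonneg fun i _ => pathNorm_nonneg A _)
        (prod_pathNorm_le hA hanti hA1 (Finset.mem_Icc.mp hk).1 (fun i => (hn1 i).1)
          (by omega : ∑ i, 2 * n i ≤ ℓ)))
      ring

end Bounds

/-! ### Quasirandom-forcing -/

theorem IsTournamenton.two_mul_sub_one {W : I → I → ℝ} (hW : IsTournamenton W) :
    IsKernel (fun x y => 2 * W x y - 1) ∧ (∀ x y, 2 * W x y - 1 = -(2 * W y x - 1)) ∧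
      ∀ x y, |2 * W x y - 1| ≤ 1 := by
  obtain ⟨⟨hm, -⟩, h0, h1⟩ := hW
  have hle : ∀ x y, |2 * W x y - 1| ≤ 1 := fun x y => by
    rw [abs_le]
    constructor <;> linarith [h0 x y, h0 y x, h1 x y]
  exact ⟨⟨(hm.const_mul 2).sub_const 1, 1, hle⟩, fun x y => by linarith [h1 x y], hle⟩

/-- If the path terms of the expansion have the sign of `γ_C`, the cycle is
quasirandom-forcing. -/
theorem IsCycleOrientation.quasirandomForcing {V : Type*} [Fintype V] {C : OrientedGraph V} {ℓ : ℕ}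
    (hC : C.IsCycleOrientation ℓ) (hℓ : Even ℓ)
    (h : ∀ A : I → I → ℝ, IsKernel A → (∀ x y, A x y = -A y x) → (∀ x y, |A x y| ≤ 1) →
      0 ≤ (C.gamma : ℝ) * ∑ p ∈ pathTuples ℓ, (C.alpha p.2 : ℝ) * ∏ i, pathNorm A (p.2 i))
    (hγ : (C.gamma : ℝ) * C.gamma = 1) : C.QuasirandomForcing := by
  intro W hW hdens
  obtain ⟨hA, hanti, hA1⟩ := hW.two_mul_sub_one
  have hexp := hC.homDensity_eq (isTupleSet_pathTuples hℓ) hA hanti (W := W) fun x y => by ring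
  have hpos := h _ hA hanti hA1
  obtain ⟨j, rfl⟩ : ∃ j, ℓ = 2 * (j + 1 + 1) := by
    obtain ⟨m, rfl⟩ := hℓ
    have := hC.1
    exact ⟨m - 2, by omega⟩
  rw [hdens, hC.homDensity_eq_gamma hA hanti] at hexp
  set S := ∑ p ∈ pathTuples (2 * (j + 1 + 1)), (C.alpha p.2 : ℝ) *
    ∏ i, pathNorm (fun x y => 2 * W x y - 1) (p.2 i)
  have hN : 0 ≤ cycleNorm (fun x y => 2 * W x y - 1) (j + 1) :=
    integral_nonneg fun a => integral_nonneg fun x => sq_nonneg _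
  have hz : (C.gamma : ℝ) * cycleNorm (fun x y => 2 * W x y - 1) (j + 1) + S = 0 := by
    have := mul_left_cancel₀ (by positivity) ((mul_one _).trans hexp)
    linarith
  -- Multiplying `γ N + S = 0` by `γ` gives `N = -γ S ≤ 0`, while `N ≥ 0`.
  have hN0 : cycleNorm (fun x y => 2 * W x y - 1) (j + 1) = 0 := by
    have e : (C.gamma : ℝ) * S = -cycleNorm (fun x y => 2 * W x y - 1) (j + 1) := by
      linear_combination (C.gamma : ℝ) * hz - cycleNorm (fun x y => 2 * W x y - 1) (j + 1) * hγ
    linarith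
  filter_upwards [ae_eq_zero_of_cycleNorm hA hanti j hN0] with p hp
  linarith

end OrientedGraph

theorem mainTheorem6 {V : Type*} [Fintype V] (C : OrientedGraph V) (ℓ : ℕ)
    (hC : C.IsCycleOrientation ℓ) (hℓ : Even ℓ) :
    (C.gamma = 1 →
      0 ≤ (C.alpha ![1] : ℝ) / 2 ^ (ℓ - 2) +
        ∑ n₁ ∈ Finset.Icc 2 (ℓ / 2 - 1),
          min 0 (C.alpha ![n₁] : ℝ) / (Real.pi ^ (2 * n₁ - 2) * 2 ^ (ℓ - 2 * n₁)) →
      0 ≤ (C.alpha ![1, 1] : ℝ) / 2 ^ (ℓ - 4) +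
        ∑ k ∈ Finset.Icc 2 ℓ, ∑ n ∈ OrientedGraph.tuples ℓ k,
          min 0 (C.alpha n : ℝ) /
            (12 ^ (k - 2) * Real.pi ^ ((∑ i, 2 * n i) - 2 * k) * 2 ^ (ℓ - ∑ i, 2 * n i)) →
      C.QuasirandomForcing) ∧
    (C.gamma = -1 →
      (C.alpha ![1] : ℝ) / 2 ^ (ℓ - 2) +
        ∑ n₁ ∈ Finset.Icc 2 (ℓ / 2 - 1),
          max 0 (C.alpha ![n₁] : ℝ) / (Real.pi ^ (2 * n₁ - 2) * 2 ^ (ℓ - 2 * n₁)) ≤ 0 →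
      (C.alpha ![1, 1] : ℝ) / 2 ^ (ℓ - 4) +
        ∑ k ∈ Finset.Icc 2 ℓ, ∑ n ∈ OrientedGraph.tuples ℓ k,
          max 0 (C.alpha n : ℝ) /
            (12 ^ (k - 2) * Real.pi ^ ((∑ i, 2 * n i) - 2 * k) * 2 ^ (ℓ - ∑ i, 2 * n i)) ≤ 0 →
      C.QuasirandomForcing) := by
  have hℓ4 : 4 ≤ ℓ := by
    obtain ⟨m, rfl⟩ := hℓ
    have := hC.1
    omega
  have hmin : ∀ b : ℝ, min 0 (-b) = -max 0 b := fun b => by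
    rw [← min_neg_neg, neg_zero]
  refine ⟨fun hγ h1 h2 => hC.quasirandomForcing hℓ (fun A hA hanti hA1 => ?_) (by simp [hγ]),
    fun hγ h1 h2 => hC.quasirandomForcing hℓ (fun A hA hanti hA1 => ?_) (by simp [hγ])⟩
  · rw [hγ, Int.cast_one, one_mul]
    exact OrientedGraph.sum_pathTuples_nonneg hA hanti hA1 hℓ4 (fun {k} n => (C.alpha n : ℝ)) h1 h2
  -- For `γ_C = -1` the bound is applied to the negated coefficients, which turns each `max` into a
  -- `min`.
  · have h := OrientedGraph.sum_pathTuples_nonneg hA hanti hA1 hℓ4 (fun {k} n => -(C.alpha n : ℝ)) ?_ ?_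
    · simpa [hγ, Finset.sum_neg_distrib] using h
    · simp only [hmin, neg_div, Finset.sum_neg_distrib]
      linarith
    · simp only [hmin, neg_div, Finset.sum_neg_distrib]
      linarith
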